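/- Let $n\ge 3$, let $\mathbb S^n\subset\mathbb R^{n+1}$ be the unit sphere with its round metric, let $\mathbf n=(0,\dots,0,1)$, $\mathbf s=(0,\dots,0,-1)$, and let $\mathcal L_{\mathbb S^n}=\Delta_{\mathbb S^n}-\frac{n(n-2)}4$ be the conformal Laplacian, where $\Delta_{\mathbb S^n}$ is the Laplace–Beltrami operator. Let $g:(\mathbb S^n\setminus\{\mathbf n,\mathbf s\})\times(0,\infty)\to\mathbb R$ be continuous, and suppose that for each $s\in(0,\infty)$ the function $g(\cdot,s)$ is bounded from below on $\mathbb S^n\setminus\{\mathbf n,\mathbf s\}$. Assume: (g1) for each $s>0$, the function $\theta\mapsto g(\theta,s)$ is rotationally symmetric about the line through $\mathbf n$ and $\mathbf s$; (g3) for each $\theta\in\mathbb S^n\setminus\{\mathbf n,\mathbf s\}$, the function $s\mapsto s^{-(n+2)/(n-2)}g(\theta,s)$ is non-increasing on $(0,\infty)$; (g5) for each $s>0$ and any $\theta,\theta'\in\mathbb S^n\setminus\{\mathbf n,\mathbf s\}$ on the same geodesic (great circle) through $\mathbf n$ and $\mathbf s$, one has $g(\theta,s)\ge g(\theta',s)$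 if $\theta_{n+1}>\theta'_{n+1}>0$, and $g(\theta,s)\ge g(\theta',s)$ if $\theta_{n+1}<\theta'_{n+1}<0$; (g6) either all the inequalities between values of $g$ in (g5) are strict, or for every $\theta\in\mathbb S^n\setminus\{\mathbf n,\mathbf s\}$ the function in (g3) is strictly decreasing on $(0,\infty)$. If $v\in C^2(\mathbb S^n\setminus\{\mathbf n,\mathbf s\})$ satisfies $$-\mathcal L_{\mathbb S^n}v=g(\theta,v)\quad\text{and}\quad v>0\quad\text{on }\mathbb S^n\setminus\{\mathbf n,\mathbf s\},$$ and $$\liminf_{\theta\to\mathbf n}v(\theta)>0,\qquad \liminf_{\theta\to\mathbf s}v(\theta)>0,$$ then $v$ is rotationally symmetric about the line through $\mathbf n$ and $\mathbf s$; that is, $v(R\theta)=v(\theta)$ for every $\theta\in\mathbb S^n\setminus\{\mathbf n,\mathbf s\}$ and every orthogonal transformation $R$ of $\mathbb R^{n+1}$ with $R\mathbf n=\mathbf n$. -/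

import Mathlib

open scoped Manifold ContDiff Topology

noncomputable section

namespace SphereSymmetry

/-- The unit sphere `𝕊ⁿ ⊂ ℝⁿ⁺¹`, with the smooth manifold structure that Mathlib gives it. -/
abbrev UnitSphere (n : ℕ) : Type :=
  Metric.sphere (0 : EuclideanSpace ℝ (Fin (n + 1))) 1

/-- The north pole `(0, …, 0, 1)`. -/
def northPole (n : ℕ) : UnitSphere n :=
  ⟨EuclideanSpace.single (Fin.last n) 1, by simp⟩

/-- The south pole `(0, …, 0, -1)`. -/
def southPole (n : ℕ) : UnitSphere n := -northPole n

/-- The twice punctured sphere: all points other than the two poles. -/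
def puncturedSphere (n : ℕ) : Set (UnitSphere n) :=
  {θ | θ ≠ northPole n ∧ θ ≠ southPole n}

/-- The last coordinate `θₙ₊₁` of a point of the sphere. -/
def height {n : ℕ} (θ : UnitSphere n) : ℝ := θ.1 (Fin.last n)

/-- The extension of a function on the sphere to `ℝⁿ⁺¹ ∖ {0}` that is homogeneous of degree `0`,
`x ↦ v (x / ‖x‖)`; its value at the origin plays no role. -/
def radialExtension {n : ℕ} (v : UnitSphere n → ℝ) (x : EuclideanSpace ℝ (Fin (n + 1))) : ℝ :=
  open Classical in
  if h : x = 0 then 0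
  else v ⟨‖x‖⁻¹ • x, by simp [norm_smul, inv_mul_cancel₀ (norm_ne_zero_iff.mpr h)]⟩

/-- The Laplace–Beltrami operator of the round metric on `𝕊ⁿ`: the Euclidean Laplacian of the
extension `x ↦ v (x / ‖x‖)`, evaluated on the sphere. In polar coordinates the Euclidean Laplacian
is `∂ᵣ² + (n / r) ∂ᵣ + r⁻² Δ_{𝕊ⁿ}`, and the extension does not depend on `r`. -/
def laplaceBeltrami {n : ℕ} (v : UnitSphere n → ℝ) (θ : UnitSphere n) : ℝ :=
  Laplacian.laplacian (radialExtension v) θ.1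

/-- The conformal Laplacian `Δ_{𝕊ⁿ} - n (n - 2) / 4`. -/
def conformalLaplacian {n : ℕ} (v : UnitSphere n → ℝ) (θ : UnitSphere n) : ℝ :=
  laplaceBeltrami v θ - (n : ℝ) * ((n : ℝ) - 2) / 4 * v θ

/-- The action of a linear isometry of `ℝⁿ⁺¹` on the sphere. -/
def sphereMap {n : ℕ}
    (R : EuclideanSpace ℝ (Fin (n + 1)) ≃ₗᵢ[ℝ] EuclideanSpace ℝ (Fin (n + 1)))
    (θ : UnitSphere n) : UnitSphere n :=
  ⟨R θ.1, by simp⟩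

/-- Rotational symmetry, about the line through the poles, of a function on the twice punctured
sphere: invariance under every orthogonal transformation that fixes the north pole. -/
def RotationallySymmetric {n : ℕ} (f : UnitSphere n → ℝ) : Prop :=
  ∀ R : EuclideanSpace ℝ (Fin (n + 1)) ≃ₗᵢ[ℝ] EuclideanSpace ℝ (Fin (n + 1)),
    sphereMap R (northPole n) = northPole n →
      ∀ θ ∈ puncturedSphere n, f (sphereMap R θ) = f θ

/-- The two points lie on one geodesic (great circle) through the north and south poles, that is,
in one plane through the origin that contains the poles. -/
def OnCommonPolarGeodesic {n : ℕ} (θ θ' : UnitSphere n) : Prop :=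
  ∃ W : Submodule ℝ (EuclideanSpace ℝ (Fin (n + 1))), Module.finrank ℝ W = 2 ∧
    (northPole n).1 ∈ W ∧ θ.1 ∈ W ∧ θ'.1 ∈ W

/-- In each open hemisphere and for each `s > 0`, `g (·, s)` does not decrease along polar
geodesics when one moves away from the equator. -/
def MonotoneAwayFromEquator {n : ℕ} (g : UnitSphere n → ℝ → ℝ) : Prop :=
  ∀ s : ℝ, 0 < s → ∀ θ ∈ puncturedSphere n, ∀ θ' ∈ puncturedSphere n,
    OnCommonPolarGeodesic θ θ' →
      (0 < height θ' → height θ' < height θ → g θ' s ≤ g θ s) ∧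
      (height θ' < 0 → height θ < height θ' → g θ' s ≤ g θ s)

/-- The same condition with strict inequalities. -/
def StrictMonotoneAwayFromEquator {n : ℕ} (g : UnitSphere n → ℝ → ℝ) : Prop :=
  ∀ s : ℝ, 0 < s → ∀ θ ∈ puncturedSphere n, ∀ θ' ∈ puncturedSphere n,
    OnCommonPolarGeodesic θ θ' →
      (0 < height θ' → height θ' < height θ → g θ' s < g θ s) ∧
      (height θ' < 0 → height θ < height θ' → g θ' s < g θ s)

/-- The function `s ↦ s ^ (-(n + 2) / (n - 2)) * g (θ, s)`. -/
def criticalQuotient {n : ℕ} (g : UnitSphere n → ℝ → ℝ) (θ : UnitSphere n) (s : ℝ) : ℝ :=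
  s ^ (-(((n : ℝ) + 2) / ((n : ℝ) - 2))) * g θ s

/-- `v` is a positive `C²` solution of `-ℒ v = g (θ, v)` on the twice punctured sphere. The values
of `v` at the two poles play no role. -/
structure IsPositiveSolution {n : ℕ} (g : UnitSphere n → ℝ → ℝ) (v : UnitSphere n → ℝ) :
    Prop where
  contMDiffOn : ContMDiffOn (𝓡 n) 𝓘(ℝ, ℝ) 2 v (puncturedSphere n)
  pos : ∀ θ ∈ puncturedSphere n, 0 < v θ
  equation : ∀ θ ∈ puncturedSphere n, -conformalLaplacian v θ = g θ (v θ)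

end SphereSymmetry

end

/-! The proof is the method of moving spheres, run on homogeneous functions. Extend `v` to `V`,
homogeneous of degree `k = -(n - 2) / 2`; on the sphere the Euclidean Laplacian of `V` is the
conformal Laplacian of `v`. Identify `x` with the point `(‖x‖, x)` of the light cone. For a unit
vector `e` orthogonal to the axis, the Lorentz reflection `lorentz e T` then induces the conformal
reflection in the boundary of the cap `⟪θ, e⟫ ≥ T`, and for this degree `k` the Laplacian commutes
with it (`laplacian_comp_lorentz`).

A point `θ` outside the cap goes to `ν • θ'` with `θ'` in the cap and `ν > 1`, while the component
along the axis is unchanged. So `θ'` is no farther from the equator than `θ`, and (g5), together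
with (g3) for the conformal factor, makes the reflected function a subsolution there
(`laplacian_conformalExt_lorentz_le`). The claim is that `v` dominates its reflection outside the
cap for all `T` in `(0, 1)`, hence for `T = 0`, where the reflection is the Euclidean one in the
hyperplane orthogonal to `e`. Since `e` is arbitrary, points of equal height have equal values.

The claim follows by connectedness in `T`. For `T` near 1 the positive lower bound on `v` handles
all points far from `e`, and a barrier handles the rest. Closedness is a passage to the limit.
Openness must cope with the punctures, with a reaction that is only continuous, and with the
possible loss of strictness on the equator. By (g3) the reaction satisfies a one-sided Lipschitz
bound (`sub_le_reaction`), so a barrier `ψ` touching the negative part of the difference must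
satisfy `Δψ + C'ψ ≥ 0` (`laplacian_barrier_nonneg`). `exists_barrier` supplies a `ψ` that violates
this near the poles, the equator and the boundary of the cap; on the remaining compact set the
strict inequality `DominatesReflected.lt` persists. This replaces the strong maximum principle and
the Hopf lemma. -/

namespace SphereSymmetry

/-! ### Second-order calculus for the Euclidean Laplacian -/

section Calculus

variable {E : Type*} [NormedAddCommGroup E] [InnerProductSpace ℝ E]

open Laplacian Filter
open scoped InnerProductSpace

theorem fderiv_fderiv_mul {f g : E → ℝ} {x : E} (hf : ContDiffAt ℝ 2 f x)
    (hg : ContDiffAt ℝ 2 g x) (a b : E) :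
    fderiv ℝ (fderiv ℝ (fun y => f y * g y)) x a b =
      f x * fderiv ℝ (fderiv ℝ g) x a b + g x * fderiv ℝ (fderiv ℝ f) x a b +
        fderiv ℝ f x a * fderiv ℝ g x b + fderiv ℝ g x a * fderiv ℝ f x b := by
  have h1 : fderiv ℝ (fun y => f y * g y) =ᶠ[𝓝 x]
      fun y => f y • fderiv ℝ g y + g y • fderiv ℝ f y := by
    filter_upwards [hf.eventually (by simp), hg.eventually (by simp)] with y h1 h2
    exact fderiv_fun_mul (h1.differentiableAt (by simp)) (h2.differentiableAt (by simp))
  have hf1 := (hf.fderiv_right (m := 1) (by norm_num)).differentiableAt (by simp) |>.hasFDerivAt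
  have hg1 := (hg.fderiv_right (m := 1) (by norm_num)).differentiableAt (by simp) |>.hasFDerivAt
  have hf0 := (hf.differentiableAt (by simp)).hasFDerivAt
  have hg0 := (hg.differentiableAt (by simp)).hasFDerivAt
  rw [h1.fderiv_eq, HasFDerivAt.fderiv (f := fun y => f y • fderiv ℝ g y + g y • fderiv ℝ f y)
    ((hf0.smul hg1).add (hg0.smul hf1))]
  simp
  ring

theorem fderiv_fderiv_comp {F : Type*} [NormedAddCommGroup F] [NormedSpace ℝ F] {V : F → ℝ}
    {Φ : E → F} {x : E} (hV : ContDiffAt ℝ 2 V (Φ x)) (hΦ : ContDiffAt ℝ 2 Φ x) (a b : E) :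
    fderiv ℝ (fderiv ℝ (fun y => V (Φ y))) x a b =
      fderiv ℝ (fderiv ℝ V) (Φ x) (fderiv ℝ Φ x a) (fderiv ℝ Φ x b) +
        fderiv ℝ V (Φ x) (fderiv ℝ (fderiv ℝ Φ) x a b) := by
  have h1 : fderiv ℝ (fun y => V (Φ y)) =ᶠ[𝓝 x]
      fun y => (fderiv ℝ V (Φ y)).comp (fderiv ℝ Φ y) := by
    filter_upwards [hΦ.eventually (by simp),
      hΦ.continuousAt.eventually (hV.eventually (by simp))] with y h1 h2
    exact fderiv_comp y (h2.differentiableAt (by simp)) (h1.differentiableAt (by simp))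
  have hΦ1 := (hΦ.fderiv_right (m := 1) (by norm_num)).differentiableAt (by simp) |>.hasFDerivAt
  have hV1 := (hV.fderiv_right (m := 1) (by norm_num)).differentiableAt (by simp) |>.hasFDerivAt
  have hΦ0 := (hΦ.differentiableAt (by simp)).hasFDerivAt
  rw [h1.fderiv_eq, HasFDerivAt.fderiv (f := fun y => (fderiv ℝ V (Φ y)).comp (fderiv ℝ Φ y))
    ((hV1.comp x hΦ0).clm_comp hΦ1)]
  simp
  ring

theorem fderiv_fderiv_comp_real {f f' : ℝ → ℝ} {f'' : ℝ} {h : E → ℝ} {x : E}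
    (hf : ∀ᶠ s in 𝓝 (h x), HasDerivAt f (f' s) s) (hf' : HasDerivAt f' f'' (h x))
    (hh : ContDiffAt ℝ 2 h x) (a b : E) :
    fderiv ℝ (fderiv ℝ (fun y => f (h y))) x a b =
      f'' * (fderiv ℝ h x a * fderiv ℝ h x b) + f' (h x) * fderiv ℝ (fderiv ℝ h) x a b := by
  have h1 : fderiv ℝ (fun y => f (h y)) =ᶠ[𝓝 x] fun y => f' (h y) • fderiv ℝ h y := by
    filter_upwards [hh.eventually (by simp), hh.continuousAt.eventually hf] with y h1 h2
    exact (h2.comp_hasFDerivAt y (h1.differentiableAt (by simp)).hasFDerivAt).fderiv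
  have hh1 := (hh.fderiv_right (m := 1) (by norm_num)).differentiableAt (by simp) |>.hasFDerivAt
  have hh0 := (hh.differentiableAt (by simp)).hasFDerivAt
  rw [h1.fderiv_eq, HasFDerivAt.fderiv (f := fun y => f' (h y) • fderiv ℝ h y)
    ((hf'.comp_hasFDerivAt x hh0).smul hh1)]
  simp
  ring

theorem fderiv_inner_left (b x a : E) : fderiv ℝ (fun y : E => ⟪y, b⟫_ℝ) x a = ⟪b, a⟫_ℝ := by
  have : HasFDerivAt (fun y : E => ⟪y, b⟫_ℝ) (innerSL ℝ b) x := by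
    simpa [real_inner_comm] using (innerSL ℝ b).hasFDerivAt (x := x)
  rw [this.fderiv]
  simp

theorem fderiv_norm_sq' (x a : E) : fderiv ℝ (fun y : E => ‖y‖ ^ 2) x a = ⟪(2 : ℝ) • x, a⟫_ℝ := by
  simp [inner_smul_left]

theorem norm_rpow_eq {E : Type*} [NormedAddCommGroup E] (k : ℝ) (x : E) :
    ‖x‖ ^ k = (‖x‖ ^ 2) ^ (k / 2) := by
  rw [← Real.rpow_natCast_mul (norm_nonneg x)]
  congr 1
  push_cast
  ring

theorem contDiffAt_norm_rpow (k : ℝ) {x : E} (hx : x ≠ 0) :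
    ContDiffAt ℝ 2 (fun y : E => ‖y‖ ^ k) x :=
  (contDiffAt_norm ℝ hx).rpow_const_of_ne (by simpa using hx)

theorem fderiv_norm_rpow_of_norm_eq_one (k : ℝ) {x : E} (hx : ‖x‖ = 1) (a : E) :
    fderiv ℝ (fun y : E => ‖y‖ ^ k) x a = ⟪k • x, a⟫_ℝ := by
  have h1 : HasFDerivAt (fun y : E => ‖y‖ ^ 2) (fderiv ℝ (fun y : E => ‖y‖ ^ 2) x) x :=
    ((contDiff_norm_sq ℝ (n := 1)).differentiable (by simp) x).hasFDerivAt
  have h2 : HasFDerivAt (fun y : E => ‖y‖ ^ k)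
      ((k / 2 * (‖x‖ ^ 2) ^ (k / 2 - 1)) • fderiv ℝ (fun y : E => ‖y‖ ^ 2) x) x := by
    simp_rw [norm_rpow_eq k]
    exact (Real.hasDerivAt_rpow_const (p := k / 2) (x := ‖x‖ ^ 2)
      (Or.inl (by simp [hx]))).comp_hasFDerivAt x h1
  rw [h2.fderiv]
  simp [hx, inner_smul_left]
  ring

variable [FiniteDimensional ℝ E]

theorem laplacian_eq_sum_fderiv (f : E → ℝ) (x : E) :
    Δ f x = ∑ i, fderiv ℝ (fderiv ℝ f) x (stdOrthonormalBasis ℝ E i)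
      (stdOrthonormalBasis ℝ E i) := by
  simp [InnerProductSpace.laplacian_eq_iteratedFDeriv_stdOrthonormalBasis,
    iteratedFDeriv_two_apply]

theorem sum_inner_stdOrthonormalBasis (p q : E) :
    ∑ i, ⟪p, stdOrthonormalBasis ℝ E i⟫_ℝ * ⟪q, stdOrthonormalBasis ℝ E i⟫_ℝ = ⟪p, q⟫_ℝ := by
  rw [← (stdOrthonormalBasis ℝ E).sum_inner_mul_inner p q]
  simp only [real_inner_comm q]

theorem laplacian_mul {f g : E → ℝ} {x p q : E} (hf : ContDiffAt ℝ 2 f x)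
    (hg : ContDiffAt ℝ 2 g x) (hp : ∀ a, fderiv ℝ f x a = ⟪p, a⟫_ℝ)
    (hq : ∀ a, fderiv ℝ g x a = ⟪q, a⟫_ℝ) :
    Δ (fun y => f y * g y) x = f x * Δ g x + g x * Δ f x + 2 * ⟪p, q⟫_ℝ := by
  simp only [laplacian_eq_sum_fderiv, fderiv_fderiv_mul hf hg, Finset.sum_add_distrib,
    ← Finset.mul_sum, hp, hq, sum_inner_stdOrthonormalBasis, real_inner_comm p q]
  ring

theorem laplacian_comp_real {f f' : ℝ → ℝ} {f'' : ℝ} {h : E → ℝ} {x p : E}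
    (hf : ∀ᶠ s in 𝓝 (h x), HasDerivAt f (f' s) s) (hf' : HasDerivAt f' f'' (h x))
    (hh : ContDiffAt ℝ 2 h x) (hp : ∀ a, fderiv ℝ h x a = ⟪p, a⟫_ℝ) :
    Δ (fun y => f (h y)) x = f'' * ⟪p, p⟫_ℝ + f' (h x) * Δ h x := by
  simp only [laplacian_eq_sum_fderiv, fderiv_fderiv_comp_real hf hf' hh, Finset.sum_add_distrib,
    ← Finset.mul_sum, hp, sum_inner_stdOrthonormalBasis]

theorem laplacian_inner_left (b x : E) : Δ (fun y : E => ⟪y, b⟫_ℝ) x = 0 := by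
  have : fderiv ℝ (fun y : E => ⟪y, b⟫_ℝ) = fun _ => innerSL ℝ b := by
    ext y a
    simp [fderiv_inner_left]
  simp [laplacian_eq_sum_fderiv, this]

theorem laplacian_norm_sq (x : E) :
    Δ (fun y : E => ‖y‖ ^ 2) x = 2 * Module.finrank ℝ E := by
  have : fderiv ℝ (fun y : E => ‖y‖ ^ 2) = ((2 : ℝ) • innerSL ℝ (E := E) : E →L[ℝ] E →L[ℝ] ℝ) := by
    ext y a
    simp
  rw [laplacian_eq_sum_fderiv, this, ContinuousLinearMap.fderiv]
  have h (b : E) : ((2 : ℝ) • innerSL ℝ (E := E) : E →L[ℝ] E →L[ℝ] ℝ) b b = 2 * ⟪b, b⟫_ℝ := rfl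
  simp only [h]
  simp [mul_comm]

theorem laplacian_norm_rpow_of_norm_eq_one (k : ℝ) {x : E} (hx : ‖x‖ = 1) :
    Δ (fun y : E => ‖y‖ ^ k) x = k * (k + Module.finrank ℝ E - 2) := by
  simp_rw [norm_rpow_eq k]
  have h0 : ‖x‖ ^ 2 ≠ 0 := by simp [hx]
  rw [laplacian_comp_real (f := fun s => s ^ (k / 2)) (f' := fun s => k / 2 * s ^ (k / 2 - 1))
    (f'' := k / 2 * ((k / 2 - 1) * (‖x‖ ^ 2) ^ (k / 2 - 1 - 1))) (h := fun y : E => ‖y‖ ^ 2)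
    (p := (2 : ℝ) • x) ?_ ?_ (contDiff_norm_sq ℝ).contDiffAt (fderiv_norm_sq' x),
    laplacian_norm_sq]
  · simp only [real_inner_self_eq_norm_sq, norm_smul, hx]
    simp
    ring
  · filter_upwards [isOpen_ne.mem_nhds h0] with s hs
    exact Real.hasDerivAt_rpow_const (Or.inl hs)
  · exact (Real.hasDerivAt_rpow_const (Or.inl h0)).const_mul _

end Calculus

/-! ### Conformal invariance of the Laplacian on homogeneous functions -/

section Lorentz

variable {E : Type*} [NormedAddCommGroup E] [InnerProductSpace ℝ E]

open Laplacian Filter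
open scoped InnerProductSpace

/-- The reflection of the light cone `{(‖x‖, x)}` in a spacelike hyperplane. On rays through the
unit sphere it induces the conformal reflection in the boundary of the cap `{⟪x, e⟫ ≥ T}`. -/
noncomputable def lorentz (e : E) (T : ℝ) (x : E) : E :=
  x + (2 / (1 - T ^ 2) * (T * ‖x‖ - ⟪x, e⟫_ℝ)) • e

theorem contDiffAt_lorentzCoeff (e : E) (T : ℝ) {x : E} (hx : x ≠ 0) :
    ContDiffAt ℝ 2 (fun y : E => 2 / (1 - T ^ 2) * (T * ‖y‖ - ⟪y, e⟫_ℝ)) x :=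
  contDiffAt_const.mul
    ((contDiffAt_const.mul (contDiffAt_norm ℝ hx)).sub (contDiffAt_id.inner ℝ contDiffAt_const))

theorem contDiffAt_lorentz (e : E) (T : ℝ) {x : E} (hx : x ≠ 0) :
    ContDiffAt ℝ 2 (lorentz e T) x :=
  contDiffAt_id.add ((contDiffAt_lorentzCoeff e T hx).smul contDiffAt_const)

/-- Euler's identity, from differentiating `t ↦ V (t • y)` at `t = 1` in two ways. -/
theorem fderiv_apply_self_of_homogeneous {V : E → ℝ} {k : ℝ} {y : E}
    (hV : DifferentiableAt ℝ V y) (hom : ∀ t : ℝ, 0 < t → V (t • y) = t ^ k * V y) :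
    fderiv ℝ V y y = k * V y := by
  have h1 : HasDerivAt (fun t : ℝ => V (t • y)) (fderiv ℝ V y y) 1 := by
    have h2 : HasDerivAt (fun t : ℝ => t • y) y 1 := by
      simpa using (hasDerivAt_id (1 : ℝ)).smul_const y
    have h3 : HasFDerivAt V (fderiv ℝ V y) ((fun t : ℝ => t • y) 1) := by
      simpa using hV.hasFDerivAt
    exact h3.comp_hasDerivAt 1 h2
  have h4 : HasDerivAt (fun t : ℝ => V (t • y)) (k * V y) 1 := by
    have h5 := (Real.hasDerivAt_rpow_const (p := k) (x := 1) (Or.inl one_ne_zero)).mul_const (V y)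
    simp only [Real.one_rpow, mul_one] at h5
    refine h5.congr_of_eventuallyEq ?_
    filter_upwards [lt_mem_nhds (zero_lt_one (α := ℝ))] with t ht using hom t ht
  exact h1.unique h4

theorem fderiv_fderiv_apply_self_of_homogeneous {V : E → ℝ} {k : ℝ} {y : E}
    (hV : ContDiffAt ℝ 2 V y) (hom : ∀ᶠ z in 𝓝 y, fderiv ℝ V z z = k * V z) (a : E) :
    fderiv ℝ (fderiv ℝ V) y a y = (k - 1) * fderiv ℝ V y a := by
  have hV1 := (hV.fderiv_right (m := 1) (by norm_num)).differentiableAt (by simp) |>.hasFDerivAt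
  have hV0 := (hV.differentiableAt (by simp)).hasFDerivAt
  have h1 := (hV1.clm_apply (hasFDerivAt_id y)).congr_of_eventuallyEq (hom.mono fun z hz => hz.symm)
  have h2 := congrArg (fun L => L a) (h1.unique (hV0.const_mul k))
  simp at h2
  linarith

variable [FiniteDimensional ℝ E]

/-- At a unit vector the derivative of the reflection is `a ↦ a + ⟪p, a⟫ e`, so the chain rule adds
three terms to `ΔV`: a cross term, a term in the `e` direction, and `Δφ` times the derivative along
`e`. The first two combine into a second derivative in the directions `e` and `Y`, which Euler's
identity reduces to first order. The total is a multiple of `2k + dim - 3`. -/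
theorem laplacian_comp_lorentz {V : E → ℝ} {k T : ℝ} {e x : E} (hx : ‖x‖ = 1) (he : ‖e‖ = 1)
    (hT : 1 - T ^ 2 ≠ 0) (hV : ContDiffAt ℝ 2 V (lorentz e T x))
    (hom : ∀ᶠ z in 𝓝 (lorentz e T x), fderiv ℝ V z z = k * V z)
    (hk : 2 * k + Module.finrank ℝ E = 3) :
    Δ (fun y => V (lorentz e T y)) x = Δ V (lorentz e T x) := by
  have hx0 : x ≠ 0 := by
    rintro rfl
    simp at hx
  set β : ℝ := 2 / (1 - T ^ 2) with hβ
  set φ : E → ℝ := fun y => β * (T * ‖y‖ - ⟪y, e⟫_ℝ) with hφ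
  have hφd : ContDiffAt ℝ 2 φ x := contDiffAt_lorentzCoeff e T hx0
  set p : E := β • (T • x - e) with hp
  have hnorm : ContDiffAt ℝ 2 (fun y : E => ‖y‖) x := contDiffAt_norm ℝ hx0
  have hinner : ContDiffAt ℝ 2 (fun y : E => ⟪y, e⟫_ℝ) x := contDiffAt_id.inner ℝ contDiffAt_const
  have hn1 (a : E) : fderiv ℝ (fun y : E => ‖y‖) x a = ⟪x, a⟫_ℝ := by
    simpa using fderiv_norm_rpow_of_norm_eq_one 1 hx a
  have hn2 : Δ (fun y : E => ‖y‖) x = Module.finrank ℝ E - 1 := by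
    have := laplacian_norm_rpow_of_norm_eq_one 1 hx
    simp only [Real.rpow_one] at this
    rw [this]
    ring
  have hφ1 (a : E) : fderiv ℝ φ x a = ⟪p, a⟫_ℝ := by
    have h1 := (((hnorm.differentiableAt (by simp)).hasFDerivAt.const_mul T).sub
      (hinner.differentiableAt (by simp)).hasFDerivAt).const_mul β
    rw [HasFDerivAt.fderiv (f := φ) h1]
    simp [hn1, fderiv_inner_left, hp, inner_smul_left, inner_sub_left]
  have hφ2 : Δ φ x = β * T * (Module.finrank ℝ E - 1) := by
    have h1 : φ = β • (T • (fun y : E => ‖y‖) - fun y : E => ⟪y, e⟫_ℝ) := rfl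
    have h2 : ContDiffAt ℝ 2 (T • (fun y : E => ‖y‖)) x := contDiffAt_const.smul hnorm
    have h3 : ContDiffAt ℝ 2 (T • (fun y : E => ‖y‖) - fun y : E => ⟪y, e⟫_ℝ) x := h2.sub hinner
    rw [h1, InnerProductSpace.laplacian_smul _ h3, h2.laplacian_sub hinner,
      InnerProductSpace.laplacian_smul _ hnorm, hn2, laplacian_inner_left]
    simp
    ring
  have hΦ : ContDiffAt ℝ 2 (lorentz e T) x := contDiffAt_lorentz e T hx0
  have hΦ1' : fderiv ℝ (lorentz e T) =ᶠ[𝓝 x]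
      fun y => ContinuousLinearMap.id ℝ E + (fderiv ℝ φ y).smulRight e := by
    filter_upwards [hφd.eventually (by simp)] with y hy
    have := (hasFDerivAt_id (𝕜 := ℝ) y).add
      ((hy.differentiableAt (by simp)).hasFDerivAt.smul_const e)
    exact HasFDerivAt.fderiv this
  have hΦ1 (a : E) : fderiv ℝ (lorentz e T) x a = a + ⟪p, a⟫_ℝ • e := by
    rw [hΦ1'.eq_of_nhds]
    simp [hφ1]
  have hΦ2 (a b : E) :
      fderiv ℝ (fderiv ℝ (lorentz e T)) x a b = fderiv ℝ (fderiv ℝ φ) x a b • e := by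
    have h1 := (hφd.fderiv_right (m := 1) (by norm_num)).differentiableAt (by simp) |>.hasFDerivAt
    have h2 : HasFDerivAt
        (fun y => ContinuousLinearMap.id ℝ E + (fderiv ℝ φ y).smulRight e) _ x :=
      ((ContinuousLinearMap.smulRightL ℝ E E).flip e |>.hasFDerivAt.comp x h1).const_add
        (ContinuousLinearMap.id ℝ E)
    rw [hΦ1'.fderiv_eq, h2.fderiv]
    simp
  set Y := lorentz e T x with hY
  set B := fderiv ℝ (fderiv ℝ V) Y with hB
  have hsymm (a b : E) : B a b = B b a :=
    (hV.isSymmSndFDerivAt (by simp)).eq a b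
  have hBY : B e Y = (k - 1) * fderiv ℝ V Y e :=
    fderiv_fderiv_apply_self_of_homogeneous hV hom e
  have hsum : ∑ i, ⟪p, stdOrthonormalBasis ℝ E i⟫_ℝ * B e (stdOrthonormalBasis ℝ E i) = B e p := by
    conv_rhs => rw [← (stdOrthonormalBasis ℝ E).sum_repr' p]
    simp [real_inner_comm p]
  have hpp : ⟪p, p⟫_ℝ = β ^ 2 * (T ^ 2 - 2 * T * ⟪x, e⟫_ℝ + 1) := by
    simp only [hp, real_inner_smul_left, real_inner_smul_right, inner_sub_left, inner_sub_right]
    simp only [real_inner_self_eq_norm_sq, hx, he, real_inner_comm x e]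
    ring
  have hβT : β * (1 - T ^ 2) = 2 := by
    rw [hβ]
    field_simp
  -- This collinearity with `Y` is where the map being a reflection of the cone enters: it lets
  -- Euler's identity evaluate the second-order terms.
  have hvec : (2 : ℝ) • p + ⟪p, p⟫_ℝ • e = (2 * β * T) • Y := by
    have h1 : ⟪p, p⟫_ℝ = 2 * β + 2 * β * T * (β * (T - ⟪x, e⟫_ℝ)) := by
      rw [hpp]
      linear_combination β * hβT
    rw [h1, hY, lorentz, ← hβ, hx, hp, mul_one]
    module
  have hquad : 2 * B e p + ⟪p, p⟫_ℝ * B e e = 2 * β * T * ((k - 1) * fderiv ℝ V Y e) := by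
    rw [← hBY]
    have := congrArg (B e) hvec
    simpa using this
  have key : ∀ i, fderiv ℝ (fderiv ℝ (fun y => V (lorentz e T y))) x (stdOrthonormalBasis ℝ E i)
      (stdOrthonormalBasis ℝ E i) =
      B (stdOrthonormalBasis ℝ E i) (stdOrthonormalBasis ℝ E i)
      + 2 * (⟪p, stdOrthonormalBasis ℝ E i⟫_ℝ * B e (stdOrthonormalBasis ℝ E i))
      + (⟪p, stdOrthonormalBasis ℝ E i⟫_ℝ * ⟪p, stdOrthonormalBasis ℝ E i⟫_ℝ) * B e e
      + fderiv ℝ (fderiv ℝ φ) x (stdOrthonormalBasis ℝ E i) (stdOrthonormalBasis ℝ E i) *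
        fderiv ℝ V Y e := by
    intro i
    rw [fderiv_fderiv_comp (Φ := lorentz e T) hV hΦ, hΦ1, hΦ2]
    simp only [map_add, map_smul, add_apply, smul_apply,
      smul_eq_mul, ← hY, ← hB, hsymm _ e]
    ring
  rw [laplacian_eq_sum_fderiv, laplacian_eq_sum_fderiv V]
  simp only [key, Finset.sum_add_distrib, ← Finset.mul_sum, ← Finset.sum_mul, hsum,
    sum_inner_stdOrthonormalBasis, ← laplacian_eq_sum_fderiv φ, hφ2]
  linear_combination hquad + β * T * fderiv ℝ V Y e * hk

end Lorentz

/-! ### Laplacians of homogeneous extensions of zonal functions -/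

section Zonal

variable {E : Type*} [NormedAddCommGroup E] [InnerProductSpace ℝ E]

open Laplacian Filter
open scoped InnerProductSpace

theorem exists_inner_eq_fderiv [CompleteSpace E] (u : E → ℝ) (x : E) :
    ∃ q : E, ∀ a, fderiv ℝ u x a = ⟪q, a⟫_ℝ :=
  ⟨(InnerProductSpace.toDual ℝ E).symm (fderiv ℝ u x), fun a => by simp⟩

theorem contDiffAt_zonalCoord (b : E) {x : E} (hx : x ≠ 0) :
    ContDiffAt ℝ 2 (fun y : E => ⟪y, b⟫_ℝ * ‖y‖ ^ (-1 : ℝ)) x :=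
  (contDiffAt_id.inner ℝ contDiffAt_const).mul (contDiffAt_norm_rpow _ hx)

theorem fderiv_zonalCoord (b : E) {x : E} (hx : ‖x‖ = 1) (a : E) :
    fderiv ℝ (fun y : E => ⟪y, b⟫_ℝ * ‖y‖ ^ (-1 : ℝ)) x a = ⟪b - ⟪x, b⟫_ℝ • x, a⟫_ℝ := by
  have hx0 : x ≠ 0 := by
    rintro rfl
    simp at hx
  have hinner : ContDiffAt ℝ 2 (fun y : E => ⟪y, b⟫_ℝ) x := contDiffAt_id.inner ℝ contDiffAt_const
  rw [fderiv_fun_mul (hinner.differentiableAt (by simp))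
    ((contDiffAt_norm_rpow _ hx0).differentiableAt (by simp))]
  simp [fderiv_inner_left, fderiv_norm_rpow_of_norm_eq_one _ hx, hx, inner_sub_left,
    real_inner_smul_left]
  ring

theorem laplacian_comp_smul [FiniteDimensional ℝ E] {V : E → ℝ} {x : E} (c : ℝ)
    (hV : ContDiffAt ℝ 2 V (c • x)) : Δ (fun y => V (c • y)) x = c ^ 2 * Δ V (c • x) := by
  have h1 (y : E) : fderiv ℝ (fun y : E => c • y) y = c • ContinuousLinearMap.id ℝ E := by
    rw [fderiv_fun_const_smul differentiableAt_fun_id, fderiv_fun_id]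
  have h2 : fderiv ℝ (fun y : E => c • y) = fun _ => c • ContinuousLinearMap.id ℝ E := funext h1
  rw [laplacian_eq_sum_fderiv, laplacian_eq_sum_fderiv V, Finset.mul_sum]
  refine Finset.sum_congr rfl fun i _ => ?_
  rw [fderiv_fderiv_comp (Φ := fun y => c • y) hV (contDiffAt_const.smul contDiffAt_id), h2]
  simp
  ring

variable [FiniteDimensional ℝ E]

/-- The cross term of the product rule vanishes because `u` has no radial derivative at `x`. -/
theorem laplacian_norm_rpow_mul (k : ℝ) {u : E → ℝ} {x : E} (hx : ‖x‖ = 1)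
    (hu : ContDiffAt ℝ 2 u x) (hu0 : fderiv ℝ u x x = 0) :
    Δ (fun y => ‖y‖ ^ k * u y) x = Δ u x + k * (k + Module.finrank ℝ E - 2) * u x := by
  have hx0 : x ≠ 0 := by
    rintro rfl
    simp at hx
  obtain ⟨q, hq⟩ := exists_inner_eq_fderiv u x
  rw [laplacian_mul (contDiffAt_norm_rpow k hx0) hu (fderiv_norm_rpow_of_norm_eq_one k hx) hq,
    laplacian_norm_rpow_of_norm_eq_one k hx, real_inner_smul_left, real_inner_comm, ← hq, hu0, hx]
  simp
  ring

theorem laplacian_zonalCoord (b : E) {x : E} (hx : ‖x‖ = 1) :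
    Δ (fun y : E => ⟪y, b⟫_ℝ * ‖y‖ ^ (-1 : ℝ)) x = -(Module.finrank ℝ E - 1) * ⟪x, b⟫_ℝ := by
  have hx0 : x ≠ 0 := by
    rintro rfl
    simp at hx
  have hinner : ContDiffAt ℝ 2 (fun y : E => ⟪y, b⟫_ℝ) x := contDiffAt_id.inner ℝ contDiffAt_const
  rw [laplacian_mul hinner (contDiffAt_norm_rpow (-1) hx0) (fderiv_inner_left b x)
    (fderiv_norm_rpow_of_norm_eq_one (-1) hx), laplacian_norm_rpow_of_norm_eq_one _ hx,
    laplacian_inner_left, real_inner_smul_right, real_inner_comm x b]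
  simp [hx]
  ring

/-- The extension, homogeneous of degree `k`, of the zonal function `f (⟪x, b⟫)` on the sphere. -/
noncomputable def zonalExt (k : ℝ) (f : ℝ → ℝ) (b : E) (y : E) : ℝ :=
  ‖y‖ ^ k * f (⟪y, b⟫_ℝ * ‖y‖ ^ (-1 : ℝ))

omit [FiniteDimensional ℝ E] in
theorem contDiffAt_zonalExt (k : ℝ) {f : ℝ → ℝ} {b x : E} (hx : ‖x‖ = 1)
    (hf : ContDiffAt ℝ 2 f ⟪x, b⟫_ℝ) : ContDiffAt ℝ 2 (zonalExt k f b) x := by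
  have hx0 : x ≠ 0 := by
    rintro rfl
    simp at hx
  refine (contDiffAt_norm_rpow k hx0).mul (ContDiffAt.comp x ?_ (contDiffAt_zonalCoord b hx0))
  simpa [hx] using hf

/-- The coordinate `t = ⟪y, b⟫ / ‖y‖` has squared gradient `1 - t ^ 2` and Laplacian `-(dim - 1) t`
on the unit sphere; the rest is the chain rule. -/
theorem laplacian_zonalExt (k : ℝ) {f f' : ℝ → ℝ} {f'' : ℝ} {b x : E} (hx : ‖x‖ = 1)
    (hb : ‖b‖ = 1) (hf : ContDiffAt ℝ 2 f ⟪x, b⟫_ℝ)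
    (hf1 : ∀ᶠ s in 𝓝 ⟪x, b⟫_ℝ, HasDerivAt f (f' s) s) (hf2 : HasDerivAt f' f'' ⟪x, b⟫_ℝ) :
    Δ (zonalExt k f b) x = (1 - ⟪x, b⟫_ℝ ^ 2) * f'' -
      (Module.finrank ℝ E - 1) * ⟪x, b⟫_ℝ * f' ⟪x, b⟫_ℝ +
      k * (k + Module.finrank ℝ E - 2) * f ⟪x, b⟫_ℝ := by
  have hx0 : x ≠ 0 := by
    rintro rfl
    simp at hx
  have hh := contDiffAt_zonalCoord b hx0
  set h : E → ℝ := fun y => ⟪y, b⟫_ℝ * ‖y‖ ^ (-1 : ℝ) with hh_def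
  have hhx : h x = ⟪x, b⟫_ℝ := by simp [hh_def, hx]
  rw [← hhx] at hf hf1 hf2
  have hu : ContDiffAt ℝ 2 (fun y => f (h y)) x := hf.comp x hh
  have hu0 : fderiv ℝ (fun y => f (h y)) x x = 0 := by
    have := hf1.self_of_nhds.comp_hasFDerivAt x (hh.differentiableAt (by simp)).hasFDerivAt
    rw [HasFDerivAt.fderiv (f := fun y => f (h y)) this]
    simp [hh_def, fderiv_zonalCoord b hx, inner_sub_left, real_inner_smul_left, hx,
      real_inner_comm x b]
  have hpp : ⟪b - ⟪x, b⟫_ℝ • x, b - ⟪x, b⟫_ℝ • x⟫_ℝ = 1 - ⟪x, b⟫_ℝ ^ 2 := by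
    simp only [real_inner_smul_left, real_inner_smul_right, inner_sub_left, inner_sub_right]
    simp only [real_inner_self_eq_norm_sq, hx, hb, real_inner_comm x b]
    ring
  have h1 : zonalExt k f b = fun y => ‖y‖ ^ k * f (h y) := rfl
  rw [h1, laplacian_norm_rpow_mul k hx hu hu0,
    laplacian_comp_real hf1 hf2 hh (fderiv_zonalCoord b hx), hpp, laplacian_zonalCoord b hx, hhx]
  ring

end Zonal

/-! ### The homogeneous extension of a function on the punctured sphere -/

section Extension

variable {n : ℕ}

open Laplacian Filter
open scoped InnerProductSpace

/-- The exponent `-(n - 2) / 2`. The Euclidean Laplacian of the extension of this degree of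
homogeneity is the conformal Laplacian. -/
noncomputable def conformalWeight (n : ℕ) : ℝ := -(((n : ℝ) - 2) / 2)

/-- The extension of `v` that is homogeneous of degree `-(n - 2) / 2`. -/
noncomputable def conformalExt (v : UnitSphere n → ℝ) (x : EuclideanSpace ℝ (Fin (n + 1))) : ℝ :=
  ‖x‖ ^ conformalWeight n * radialExtension v x

/-- The points that do not lie on the line through the poles. -/
def offAxis (n : ℕ) : Set (EuclideanSpace ℝ (Fin (n + 1))) :=
  {x | ⟪x, (northPole n).1⟫_ℝ ^ 2 < ‖x‖ ^ 2}

/-- The radial projection to the unit sphere. -/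
noncomputable def radialProj (x : EuclideanSpace ℝ (Fin (n + 1))) (hx : x ≠ 0) : UnitSphere n :=
  ⟨‖x‖⁻¹ • x, by simp [norm_smul, inv_mul_cancel₀ (norm_ne_zero_iff.mpr hx)]⟩

theorem norm_northPole : ‖(northPole n).1‖ = 1 := norm_eq_of_mem_sphere _

theorem norm_coe_unitSphere (θ : UnitSphere n) : ‖θ.1‖ = 1 := norm_eq_of_mem_sphere θ

theorem coe_unitSphere_ne_zero (θ : UnitSphere n) : θ.1 ≠ 0 := by
  intro h
  have := norm_coe_unitSphere θ
  simp [h] at this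

theorem height_eq_inner (θ : UnitSphere n) : height θ = ⟪θ.1, (northPole n).1⟫_ℝ := by
  simp [height, northPole, EuclideanSpace.inner_single_right]

theorem isOpen_offAxis : IsOpen (offAxis n) := by
  refine isOpen_lt ?_ ?_ <;> fun_prop

theorem ne_zero_of_mem_offAxis {x : EuclideanSpace ℝ (Fin (n + 1))} (hx : x ∈ offAxis n) :
    x ≠ 0 := by
  rintro rfl
  simp [offAxis] at hx

theorem smul_mem_offAxis {x : EuclideanSpace ℝ (Fin (n + 1))} (hx : x ∈ offAxis n) {t : ℝ}
    (ht : t ≠ 0) : t • x ∈ offAxis n := by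
  simp only [offAxis, Set.mem_ofPred_eq, real_inner_smul_left, norm_smul, mul_pow,
    Real.norm_eq_abs, sq_abs] at hx ⊢
  have : 0 < t ^ 2 := by positivity
  gcongr

theorem mem_puncturedSphere_iff (θ : UnitSphere n) :
    θ ∈ puncturedSphere n ↔ θ.1 ∈ offAxis n := by
  have h1 := norm_coe_unitSphere θ
  have h2 := norm_northPole (n := n)
  have hle := abs_real_inner_le_norm θ.1 (northPole n).1
  rw [h1, h2, mul_one] at hle
  have e1 : θ = northPole n ↔ ⟪θ.1, (northPole n).1⟫_ℝ = 1 := by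
    rw [inner_eq_one_iff_of_norm_eq_one h1 h2]
    exact Subtype.ext_iff
  have e2 : θ = southPole n ↔ ⟪θ.1, (northPole n).1⟫_ℝ = -1 := by
    have : ⟪θ.1, (northPole n).1⟫_ℝ = -1 ↔ ⟪θ.1, -(northPole n).1⟫_ℝ = 1 := by
      rw [inner_neg_right]
      constructor <;> intro h <;> linarith
    rw [this, inner_eq_one_iff_of_norm_eq_one h1 (by rwa [norm_neg])]
    exact Subtype.ext_iff
  simp only [puncturedSphere, offAxis, Set.mem_ofPred_eq, h1, ne_eq, e1, e2, one_pow]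
  rw [sq_lt_one_iff_abs_lt_one, hle.lt_iff_ne, ne_eq, abs_eq zero_le_one, not_or]

/-- A vector on the axis is orthogonal to `e`. Hence caps around `e`, and images of reflections with
positive `e`-component, avoid the poles. -/
theorem mem_offAxis_of_inner_ne_zero {e x : EuclideanSpace ℝ (Fin (n + 1))}
    (he : ⟪e, (northPole n).1⟫_ℝ = 0) (hx : ⟪x, e⟫_ℝ ≠ 0) : x ∈ offAxis n := by
  set N := (northPole n).1 with hN
  have h1 : ‖x - ⟪x, N⟫_ℝ • N‖ ^ 2 = ‖x‖ ^ 2 - ⟪x, N⟫_ℝ ^ 2 := by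
    rw [norm_sub_sq_real, norm_smul, real_inner_smul_right, norm_northPole]
    simp
    ring
  have h2 : x - ⟪x, N⟫_ℝ • N ≠ 0 := by
    intro h
    apply hx
    rw [sub_eq_zero.mp h, real_inner_smul_left, real_inner_comm e, he, mul_zero]
  have h3 : 0 < ‖x - ⟪x, N⟫_ℝ • N‖ ^ 2 := by positivity
  rw [h1] at h3
  exact sub_pos.mp h3

theorem radialProj_mem_puncturedSphere {x : EuclideanSpace ℝ (Fin (n + 1))} (hx : x ∈ offAxis n) :
    radialProj x (ne_zero_of_mem_offAxis hx) ∈ puncturedSphere n := by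
  rw [mem_puncturedSphere_iff]
  exact smul_mem_offAxis hx (inv_ne_zero (norm_ne_zero_iff.mpr (ne_zero_of_mem_offAxis hx)))

theorem radialExtension_eq (v : UnitSphere n → ℝ) {x : EuclideanSpace ℝ (Fin (n + 1))}
    (hx : x ≠ 0) : radialExtension v x = v (radialProj x hx) := by
  simp only [radialExtension, dif_neg hx]
  rfl

theorem conformalExt_eq (v : UnitSphere n → ℝ) {x : EuclideanSpace ℝ (Fin (n + 1))}
    (hx : x ≠ 0) : conformalExt v x = ‖x‖ ^ conformalWeight n * v (radialProj x hx) := by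
  rw [conformalExt, radialExtension_eq v hx]

theorem radialProj_coe (θ : UnitSphere n) : radialProj θ.1 (coe_unitSphere_ne_zero θ) = θ := by
  ext1
  simp [radialProj]

theorem conformalExt_coe (v : UnitSphere n → ℝ) (θ : UnitSphere n) : conformalExt v θ.1 = v θ := by
  rw [conformalExt_eq v (coe_unitSphere_ne_zero θ), radialProj_coe, norm_coe_unitSphere]
  simp

theorem radialExtension_smul (v : UnitSphere n → ℝ) {x : EuclideanSpace ℝ (Fin (n + 1))}
    (hx : x ≠ 0) {t : ℝ} (ht : 0 < t) : radialExtension v (t • x) = radialExtension v x := by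
  rw [radialExtension_eq v hx, radialExtension_eq v (smul_ne_zero ht.ne' hx)]
  congr 1
  ext1
  simp only [radialProj, norm_smul, Real.norm_eq_abs, abs_of_pos ht, smul_smul]
  congr 1
  field_simp

theorem conformalExt_smul (v : UnitSphere n → ℝ) {x : EuclideanSpace ℝ (Fin (n + 1))}
    (hx : x ≠ 0) {t : ℝ} (ht : 0 < t) :
    conformalExt v (t • x) = t ^ conformalWeight n * conformalExt v x := by
  rw [conformalExt, conformalExt, radialExtension_smul v hx ht, norm_smul, Real.norm_eq_abs,
    abs_of_pos ht, Real.mul_rpow ht.le (norm_nonneg x), mul_assoc]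

theorem isOpen_puncturedSphere : IsOpen (puncturedSphere n) := by
  have : puncturedSphere n = Subtype.val ⁻¹' offAxis n := Set.ext mem_puncturedSphere_iff
  rw [this]
  exact isOpen_offAxis.preimage continuous_subtype_val

/-- The extension is `v` composed with the radial retraction, which is smooth as a map from the open
complement of the origin into the sphere. -/
theorem contDiffAt_radialExtension {v : UnitSphere n → ℝ}
    (hv : ContMDiffOn (𝓡 n) 𝓘(ℝ, ℝ) 2 v (puncturedSphere n))
    {x : EuclideanSpace ℝ (Fin (n + 1))} (hx : x ∈ offAxis n) :
    ContDiffAt ℝ 2 (radialExtension v) x := by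
  let O : TopologicalSpace.Opens (EuclideanSpace ℝ (Fin (n + 1))) := ⟨{x | x ≠ 0}, isOpen_ne⟩
  have hf : ContMDiff 𝓘(ℝ, EuclideanSpace ℝ (Fin (n + 1))) 𝓘(ℝ, EuclideanSpace ℝ (Fin (n + 1))) 2
      (fun y : O => ‖y.1‖⁻¹ • y.1) := by
    intro y
    refine contMDiffAt_subtype_iff (f := fun y : EuclideanSpace ℝ (Fin (n + 1)) => ‖y‖⁻¹ • y)
      |>.mpr (ContDiffAt.contMDiffAt ?_)
    exact ((contDiffAt_norm ℝ y.2).inv (norm_ne_zero_iff.mpr y.2)).smul contDiffAt_id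
  have hf' : ∀ y : O, ‖y.1‖⁻¹ • y.1 ∈ Metric.sphere (0 : EuclideanSpace ℝ (Fin (n + 1))) 1 :=
    fun y => (radialProj y.1 y.2).2
  have hx0 := ne_zero_of_mem_offAxis hx
  have : Fact (Module.finrank ℝ (EuclideanSpace ℝ (Fin (n + 1))) = n + 1) := ⟨by simp⟩
  have h1 := hf.codRestrict_sphere (n := n) hf'
  have h2 : ContMDiffAt (𝓡 n) 𝓘(ℝ, ℝ) 2 v (radialProj x hx0) :=
    hv.contMDiffAt (isOpen_puncturedSphere.mem_nhds (radialProj_mem_puncturedSphere hx))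
  have h3 := ContMDiffAt.comp (⟨x, hx0⟩ : O) h2 h1.contMDiffAt
  rw [← contMDiffAt_iff_contDiffAt]
  refine contMDiffAt_subtype_iff (U := O) (x := ⟨x, hx0⟩) |>.mp (h3.congr_of_eventuallyEq ?_)
  exact Eventually.of_forall fun y => radialExtension_eq v y.2

theorem contDiffAt_conformalExt {v : UnitSphere n → ℝ}
    (hv : ContMDiffOn (𝓡 n) 𝓘(ℝ, ℝ) 2 v (puncturedSphere n))
    {x : EuclideanSpace ℝ (Fin (n + 1))} (hx : x ∈ offAxis n) :
    ContDiffAt ℝ 2 (conformalExt v) x :=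
  (contDiffAt_norm_rpow _ (ne_zero_of_mem_offAxis hx)).mul (contDiffAt_radialExtension hv hx)

theorem fderiv_conformalExt_apply_self {v : UnitSphere n → ℝ}
    (hv : ContMDiffOn (𝓡 n) 𝓘(ℝ, ℝ) 2 v (puncturedSphere n))
    {x : EuclideanSpace ℝ (Fin (n + 1))} (hx : x ∈ offAxis n) :
    fderiv ℝ (conformalExt v) x x = conformalWeight n * conformalExt v x :=
  fderiv_apply_self_of_homogeneous ((contDiffAt_conformalExt hv hx).differentiableAt (by simp))
    fun _ ht => conformalExt_smul v (ne_zero_of_mem_offAxis hx) ht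

theorem laplacian_conformalExt_coe {v : UnitSphere n → ℝ}
    (hv : ContMDiffOn (𝓡 n) 𝓘(ℝ, ℝ) 2 v (puncturedSphere n)) {θ : UnitSphere n}
    (hθ : θ ∈ puncturedSphere n) : Δ (conformalExt v) θ.1 = conformalLaplacian v θ := by
  have hθ' := (mem_puncturedSphere_iff θ).mp hθ
  have hu := contDiffAt_radialExtension hv hθ'
  have hu0 : fderiv ℝ (radialExtension v) θ.1 θ.1 = 0 := by
    rw [fderiv_apply_self_of_homogeneous (k := 0) (hu.differentiableAt (by simp)), zero_mul]
    intro t ht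
    rw [radialExtension_smul v (coe_unitSphere_ne_zero θ) ht, Real.rpow_zero, one_mul]
  have h1 : conformalExt v = fun x => ‖x‖ ^ conformalWeight n * radialExtension v x := rfl
  rw [h1, laplacian_norm_rpow_mul _ (norm_coe_unitSphere θ) hu hu0, conformalLaplacian,
    laplaceBeltrami, radialExtension_eq v (coe_unitSphere_ne_zero θ), radialProj_coe,
    conformalWeight, finrank_euclideanSpace, Fintype.card_fin]
  push_cast
  ring

theorem laplacian_conformalExt {v : UnitSphere n → ℝ}
    (hv : ContMDiffOn (𝓡 n) 𝓘(ℝ, ℝ) 2 v (puncturedSphere n))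
    {x : EuclideanSpace ℝ (Fin (n + 1))} (hx : x ∈ offAxis n) :
    Δ (conformalExt v) x = ‖x‖ ^ (conformalWeight n - 2) *
      conformalLaplacian v (radialProj x (ne_zero_of_mem_offAxis hx)) := by
  have hx0 := ne_zero_of_mem_offAxis hx
  have hpos : 0 < ‖x‖ := norm_pos_iff.mpr hx0
  set θ := radialProj x hx0 with hθ
  have hxθ : ‖x‖ • θ.1 = x := by
    simp [hθ, radialProj, smul_smul, hpos.ne']
  have hθm := radialProj_mem_puncturedSphere hx
  have h1 := laplacian_comp_smul (V := conformalExt v) (x := θ.1) ‖x‖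
    (by rw [hxθ]; exact contDiffAt_conformalExt hv hx)
  have h2 : (fun y : EuclideanSpace ℝ (Fin (n + 1)) => conformalExt v (‖x‖ • y)) =ᶠ[𝓝 θ.1]
      (‖x‖ ^ conformalWeight n) • conformalExt v := by
    filter_upwards [isOpen_ne.mem_nhds (coe_unitSphere_ne_zero θ)] with y hy
    exact conformalExt_smul v hy hpos
  rw [(InnerProductSpace.laplacian_congr_nhds h2).eq_of_nhds,
    InnerProductSpace.laplacian_smul _
      (contDiffAt_conformalExt hv ((mem_puncturedSphere_iff θ).mp hθm)),
    laplacian_conformalExt_coe hv hθm, hxθ, smul_eq_mul] at h1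
  rw [Real.rpow_sub hpos, Real.rpow_two, div_mul_eq_mul_div, h1]
  field_simp

end Extension

/-! ### Second-order conditions at a minimum -/

section LocalMin

open Laplacian Filter
open scoped InnerProductSpace

/-- If `f''` were negative, the point would also be a local maximum; then `f` would be locally
constant and `f''` zero. -/
theorem deriv_deriv_nonneg_of_isLocalMin {f f' : ℝ → ℝ} {f'' x : ℝ} (h : IsLocalMin f x)
    (hf : ∀ᶠ s in 𝓝 x, HasDerivAt f (f' s) s) (hf' : HasDerivAt f' f'' x) : 0 ≤ f'' := by
  by_contra! hneg
  have h1 : deriv f =ᶠ[𝓝 x] f' := hf.mono fun s hs => hs.deriv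
  have h2 : deriv (deriv f) x = f'' := by rw [h1.deriv_eq, hf'.deriv]
  have h3 : IsLocalMax f x := isLocalMax_of_deriv_deriv_neg (by rwa [h2]) h.deriv_eq_zero
    hf.self_of_nhds.continuousAt
  have h4 : f =ᶠ[𝓝 x] fun _ => f x := by
    filter_upwards [h, h3] with s hs hs'
    exact le_antisymm hs' hs
  have h5 : deriv (deriv f) x = 0 := by
    rw [h4.deriv.deriv_eq]
    simp
  linarith

theorem laplacian_nonneg_of_isLocalMin {E : Type*} [NormedAddCommGroup E] [InnerProductSpace ℝ E]
    [FiniteDimensional ℝ E] {W : E → ℝ} {x : E} (h : IsLocalMin W x) (hW : ContDiffAt ℝ 2 W x) :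
    0 ≤ Δ W x := by
  rw [laplacian_eq_sum_fderiv]
  refine Finset.sum_nonneg fun i _ => ?_
  set b := stdOrthonormalBasis ℝ E i
  have hline (s : ℝ) : HasDerivAt (fun s : ℝ => x + s • b) b s := by
    simpa using ((hasDerivAt_id s).smul_const b).const_add x
  have hx : (fun s : ℝ => x + s • b) 0 = x := by simp
  have hcont : Tendsto (fun s : ℝ => x + s • b) (𝓝 0) (𝓝 x) := by
    conv_rhs => rw [← hx]
    exact (hline 0).continuousAt
  have hW1 := (hW.fderiv_right (m := 1) (by norm_num)).differentiableAt (by simp) |>.hasFDerivAt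
  refine deriv_deriv_nonneg_of_isLocalMin (f := fun s : ℝ => W (x + s • b)) (x := 0)
    (f' := fun s => fderiv ℝ W (x + s • b) b) ?_ ?_ ?_
  · have := hcont.eventually h
    simpa [IsLocalMin, IsMinFilter] using this
  · filter_upwards [hcont.eventually (hW.eventually (by simp))] with s hs
    exact (hs.differentiableAt (by simp)).hasFDerivAt.comp_hasDerivAt s (hline s)
  · have h1 : HasFDerivAt (fderiv ℝ W) (fderiv ℝ (fderiv ℝ W) x) ((fun s : ℝ => x + s • b) 0) := by
      rw [hx]
      exact hW1
    have h2 : HasDerivAt (fun s : ℝ => fderiv ℝ W (x + s • b)) (fderiv ℝ (fderiv ℝ W) x b) 0 :=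
      h1.comp_hasDerivAt (0 : ℝ) (hline 0)
    exact ((ContinuousLinearMap.apply ℝ ℝ b).hasFDerivAt.comp_hasDerivAt (0 : ℝ) h2)

end LocalMin

/-! ### Geometry of the reflection on the unit sphere -/

section LorentzSphere

variable {E : Type*} [NormedAddCommGroup E] [InnerProductSpace ℝ E]

open Filter
open scoped InnerProductSpace

theorem two_div_mul_cancel {T : ℝ} (hT : T ∈ Set.Ico 0 1) : 2 / (1 - T ^ 2) * (1 - T ^ 2) = 2 := by
  have : 1 - T ^ 2 ≠ 0 := by nlinarith [hT.1, hT.2]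
  field_simp

theorem norm_lorentz {e x : E} {T : ℝ} (hx : ‖x‖ = 1) (he : ‖e‖ = 1) (hT : T ∈ Set.Ico 0 1) :
    ‖lorentz e T x‖ = 1 + 2 / (1 - T ^ 2) * (T * (T - ⟪x, e⟫_ℝ)) := by
  set β := 2 / (1 - T ^ 2) with hβ
  have hβT := two_div_mul_cancel hT
  rw [← hβ] at hβT
  have hxe : ⟪x, e⟫_ℝ ≤ 1 := by
    have := real_inner_le_norm x e
    rwa [hx, he, mul_one] at this
  have hT1 : 0 < 1 - T ^ 2 := by nlinarith [hT.1, hT.2]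
  have hβ0 : 0 < β := div_pos two_pos hT1
  have hnonneg : 0 ≤ 1 + β * (T * (T - ⟪x, e⟫_ℝ)) := by
    have : 1 + β * (T * (T - ⟪x, e⟫_ℝ)) = β / 2 * (1 - T ^ 2 + 2 * (T * (T - ⟪x, e⟫_ℝ))) := by
      linear_combination (-1 / 2 : ℝ) * hβT
    rw [this]
    -- The expression decreases in `⟪x, e⟫`, and at `⟪x, e⟫ = 1` it equals `(1 - T) ^ 2`.
    have : 0 ≤ 1 - T ^ 2 + 2 * (T * (T - ⟪x, e⟫_ℝ)) := by
      nlinarith [sq_nonneg (1 - T), mul_nonneg hT.1 (sub_nonneg.mpr hxe)]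
    positivity
  rw [← abs_of_nonneg (norm_nonneg (lorentz e T x)), ← abs_of_nonneg hnonneg,
    ← sq_eq_sq_iff_abs_eq_abs, lorentz, norm_add_sq_real, norm_smul, real_inner_smul_right, hx, he, ← hβ, mul_one, mul_one,
    Real.norm_eq_abs, sq_abs]
  linear_combination β * (T - ⟪x, e⟫_ℝ) ^ 2 * hβT

theorem inner_lorentz_of_orthogonal {e N : E} (he : ⟪e, N⟫_ℝ = 0) (T : ℝ) (x : E) :
    ⟪lorentz e T x, N⟫_ℝ = ⟪x, N⟫_ℝ := by
  simp [lorentz, inner_add_left, real_inner_smul_left, he]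

theorem inner_lorentz {e x : E} {T : ℝ} (hx : ‖x‖ = 1) (he : ‖e‖ = 1) (hT : T ∈ Set.Ico 0 1) :
    ⟪lorentz e T x, e⟫_ℝ = T * ‖lorentz e T x‖ + (T - ⟪x, e⟫_ℝ) := by
  have hβT := two_div_mul_cancel hT
  rw [norm_lorentz hx he hT, lorentz, inner_add_left, real_inner_smul_left,
    real_inner_self_eq_norm_sq, hx, he]
  linear_combination (T - ⟪x, e⟫_ℝ) * hβT

theorem lorentz_smul (e : E) (T : ℝ) {t : ℝ} (ht : 0 < t) (x : E) :
    lorentz e T (t • x) = t • lorentz e T x := by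
  simp only [lorentz, norm_smul, real_inner_smul_left, Real.norm_eq_abs, abs_of_pos ht]
  module

theorem lorentz_eq_self {e x : E} {T : ℝ} (hx : ‖x‖ = 1) (ht : ⟪x, e⟫_ℝ = T) :
    lorentz e T x = x := by
  simp [lorentz, hx, ht]

theorem one_lt_norm_lorentz {e x : E} {T : ℝ} (hx : ‖x‖ = 1) (he : ‖e‖ = 1)
    (hT : T ∈ Set.Ioo 0 1) (ht : ⟪x, e⟫_ℝ < T) : 1 < ‖lorentz e T x‖ := by
  have h1 : 0 < 1 - T ^ 2 := by nlinarith [hT.1, hT.2]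
  have h2 : 0 < T - ⟪x, e⟫_ℝ := sub_pos.mpr ht
  have h3 := hT.1
  rw [norm_lorentz hx he ⟨hT.1.le, hT.2⟩]
  have : 0 < 2 / (1 - T ^ 2) * (T * (T - ⟪x, e⟫_ℝ)) := by positivity
  linarith

theorem inner_lorentz_pos {e x : E} {T : ℝ} (hx : ‖x‖ = 1) (he : ‖e‖ = 1)
    (hT : T ∈ Set.Ico 0 1) (ht : ⟪x, e⟫_ℝ < T) : 0 < ⟪lorentz e T x, e⟫_ℝ := by
  rw [inner_lorentz hx he hT]
  have := mul_nonneg hT.1 (norm_nonneg (lorentz e T x))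
  linarith

end LorentzSphere

/-! ### Comparison at a touching point -/

section Comparison

variable {n : ℕ}

open Laplacian Filter
open scoped InnerProductSpace

/-- At an interior minimum on the sphere, the comparison of a solution with its reflection. -/
theorem reaction_le_of_local_min {g : UnitSphere n → ℝ → ℝ} {v : UnitSphere n → ℝ}
    (hv : IsPositiveSolution g v) {e : EuclideanSpace ℝ (Fin (n + 1))} (he : ‖e‖ = 1)
    {T : ℝ} (hT : T ∈ Set.Ico 0 1) {θ : UnitSphere n} (hθ : θ ∈ puncturedSphere n)
    (hY : lorentz e T θ.1 ∈ offAxis n) {Ψ : EuclideanSpace ℝ (Fin (n + 1)) → ℝ}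
    (hΨ : ContDiffAt ℝ 2 Ψ θ.1)
    (hom : ∀ y, y ≠ 0 → ∀ t : ℝ, 0 < t → Ψ (t • y) = t ^ conformalWeight n * Ψ y)
    (hmin : ∀ᶠ θ' in 𝓝 θ, 0 ≤ v θ' - conformalExt v (lorentz e T θ'.1) + Ψ θ'.1)
    (heq : v θ - conformalExt v (lorentz e T θ.1) + Ψ θ.1 = 0) :
    g θ (v θ) ≤ -Δ (conformalExt v) (lorentz e T θ.1) + Δ Ψ θ.1 := by
  have hθ' := (mem_puncturedSphere_iff θ).mp hθ
  have hθ1 := norm_coe_unitSphere θ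
  have hθ0 := coe_unitSphere_ne_zero θ
  have hC := hv.contMDiffOn
  have hL : ContDiffAt ℝ 2 (lorentz e T) θ.1 := contDiffAt_lorentz e T hθ0
  have hV1 := contDiffAt_conformalExt hC hθ'
  have hVY := contDiffAt_conformalExt hC hY
  have hV2 : ContDiffAt ℝ 2 (fun y => conformalExt v (lorentz e T y)) θ.1 := hVY.comp θ.1 hL
  have hV3 : ContDiffAt ℝ 2 (conformalExt v - fun y => conformalExt v (lorentz e T y)) θ.1 :=
    hV1.sub hV2
  set W : EuclideanSpace ℝ (Fin (n + 1)) → ℝ :=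
    (conformalExt v - fun y => conformalExt v (lorentz e T y)) + Ψ with hW
  have hWθ : W θ.1 = 0 := by
    simp only [hW, Pi.add_apply, Pi.sub_apply, conformalExt_coe]
    exact heq
  -- The minimum is known only along the sphere. It extends to a full neighbourhood because `W` is
  -- homogeneous and its minimal value is zero, so only the sign matters on each ray.
  have hmin' : IsLocalMin W θ.1 := by
    have hproj : ContinuousAt (fun y : EuclideanSpace ℝ (Fin (n + 1)) => ‖y‖⁻¹ • y) θ.1 :=
      (continuousAt_id.norm.inv₀ (by simp)).smul continuousAt_id
    have hproj1 : ‖θ.1‖⁻¹ • θ.1 = θ.1 := by simp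
    rw [nhds_subtype_eq_comap, eventually_comap] at hmin
    rw [ContinuousAt, hproj1] at hproj
    have hne : ∀ᶠ y in 𝓝 θ.1, lorentz e T y ≠ 0 :=
      hL.continuousAt.eventually_ne (ne_zero_of_mem_offAxis hY)
    filter_upwards [hproj.eventually hmin, hne, isOpen_ne.mem_nhds hθ0] with y hy hy1 hy0
    have hpos : 0 < ‖y‖ := norm_pos_iff.mpr hy0
    have h1 := hy (radialProj y hy0) rfl
    have h2 : (radialProj y hy0).1 = ‖y‖⁻¹ • y := rfl
    rw [← conformalExt_coe v (radialProj y hy0), h2, conformalExt_smul v hy0 (inv_pos.mpr hpos),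
      lorentz_smul e T (inv_pos.mpr hpos), conformalExt_smul v hy1 (inv_pos.mpr hpos),
      hom y hy0 _ (inv_pos.mpr hpos), ← mul_sub, ← mul_add] at h1
    rw [hWθ]
    exact nonneg_of_mul_nonneg_right h1 (Real.rpow_pos_of_pos (inv_pos.mpr hpos) _)
  have hlap := laplacian_nonneg_of_isLocalMin hmin' (hV3.add hΨ)
  have hT1 : 1 - T ^ 2 ≠ 0 := by nlinarith [hT.1, hT.2]
  rw [hV3.laplacian_add hΨ, hV1.laplacian_sub hV2, laplacian_conformalExt_coe hC hθ,
    laplacian_comp_lorentz (k := conformalWeight n) hθ1 he hT1 hVY] at hlap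
  · have := hv.equation θ hθ
    linarith
  · filter_upwards [isOpen_offAxis.mem_nhds hY] with z hz
    exact fderiv_conformalExt_apply_self hC hz
  · rw [finrank_euclideanSpace, Fintype.card_fin, conformalWeight]
    push_cast
    ring

end Comparison

/-! ### Consequences of the monotonicity hypotheses on `g` -/

section Reaction

variable {n : ℕ}

open Laplacian Filter
open scoped InnerProductSpace

/-- The reflection exchanging the two points is in the hyperplane orthogonal to their difference,
which contains the axis when the heights agree. -/
theorem exists_reflection_of_height_eq {θ θ' : UnitSphere n} (h : height θ = height θ') :
    ∃ R : EuclideanSpace ℝ (Fin (n + 1)) ≃ₗᵢ[ℝ] EuclideanSpace ℝ (Fin (n + 1)),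
      sphereMap R (northPole n) = northPole n ∧ sphereMap R θ = θ' := by
  refine ⟨(Submodule.span ℝ {θ.1 - θ'.1})ᗮ.reflection, ?_, ?_⟩
  · ext1
    refine Submodule.reflection_mem_subspace_eq_self ?_
    rw [Submodule.mem_orthogonal_singleton_iff_inner_right, inner_sub_left, ← height_eq_inner,
      ← height_eq_inner, h, sub_self]
  · ext1
    exact Submodule.reflection_sub (by rw [norm_coe_unitSphere, norm_coe_unitSphere])

theorem eq_of_height_eq {f : UnitSphere n → ℝ} (hf : RotationallySymmetric f) {θ θ' : UnitSphere n}
    (hθ : θ ∈ puncturedSphere n) (h : height θ = height θ') : f θ' = f θ := by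
  obtain ⟨R, hR, rfl⟩ := exists_reflection_of_height_eq h
  exact hf R hR θ hθ

theorem mem_puncturedSphere_iff_height (θ : UnitSphere n) :
    θ ∈ puncturedSphere n ↔ height θ ^ 2 < 1 := by
  rw [mem_puncturedSphere_iff, offAxis, Set.mem_ofPred_eq, norm_coe_unitSphere, height_eq_inner,
    one_pow]

/-- Every height is attained on the polar geodesic through a given point. -/
theorem exists_onCommonPolarGeodesic {θ : UnitSphere n} (hθ : θ ∈ puncturedSphere n) {h : ℝ}
    (hh : h ^ 2 ≤ 1) : ∃ θ' : UnitSphere n, height θ' = h ∧ OnCommonPolarGeodesic θ θ' := by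
  set N := (northPole n).1 with hN
  have hNN : ⟪N, N⟫_ℝ = 1 := by rw [real_inner_self_eq_norm_sq, norm_northPole, one_pow]
  have hθθ : ⟪θ.1, θ.1⟫_ℝ = 1 := by rw [real_inner_self_eq_norm_sq, norm_coe_unitSphere, one_pow]
  set z := height θ with hz
  have hzN : ⟪θ.1, N⟫_ℝ = z := (height_eq_inner θ).symm
  have hNz : ⟪N, θ.1⟫_ℝ = z := by rw [real_inner_comm, hzN]
  have hq : 0 < 1 - z ^ 2 := sub_pos.mpr ((mem_puncturedSphere_iff_height θ).mp hθ)
  set c := √((1 - h ^ 2) / (1 - z ^ 2)) with hc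
  have hc2 : c ^ 2 * (1 - z ^ 2) = 1 - h ^ 2 := by
    rw [hc, Real.sq_sqrt (div_nonneg (by linarith) hq.le)]
    field_simp
  -- The coefficient of the pole forces height `h`; `c` is the value that makes the norm 1.
  set y := c • θ.1 + (h - c * z) • N with hy
  have hyn : ‖y‖ = 1 := by
    have : ‖y‖ ^ 2 = 1 := by
      rw [← real_inner_self_eq_norm_sq, hy]
      simp only [inner_add_left, inner_add_right, real_inner_smul_left, real_inner_smul_right, hNN,
        hθθ, hzN, hNz]
      linear_combination hc2
    exact (pow_eq_one_iff_of_nonneg (norm_nonneg y) two_ne_zero).mp this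
  refine ⟨⟨y, by simpa using hyn⟩, ?_, Submodule.span ℝ (Set.range ![N, θ.1]), ?_, ?_, ?_, ?_⟩
  · rw [height_eq_inner]
    simp only [hy, inner_add_left, real_inner_smul_left, hNN, hzN, ← hN]
    ring
  · rw [finrank_span_eq_card, Fintype.card_fin]
    rw [LinearIndependent.pair_iff]
    intro s t hst
    have h1 := congrArg (fun w => ⟪w, N⟫_ℝ) hst
    have h2 := congrArg (fun w => ⟪w, θ.1⟫_ℝ) hst
    simp only [inner_add_left, real_inner_smul_left, hNN, hθθ, hzN, hNz, inner_zero_left] at h1 h2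
    have ht : t * (1 - z ^ 2) = 0 := by linear_combination h2 - z * h1
    have ht0 : t = 0 := (mul_eq_zero.mp ht).resolve_right hq.ne'
    refine ⟨?_, ht0⟩
    rw [ht0] at h1
    linarith
  · exact Submodule.subset_span ⟨0, rfl⟩
  · exact Submodule.subset_span ⟨1, rfl⟩
  · exact add_mem (Submodule.smul_mem _ _ (Submodule.subset_span ⟨1, rfl⟩))
      (Submodule.smul_mem _ _ (Submodule.subset_span ⟨0, rfl⟩))

theorem exists_meridian_point {θ θ' : UnitSphere n} (hθ : θ ∈ puncturedSphere n)
    (hθ' : θ' ∈ puncturedSphere n) :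
    ∃ θ'' ∈ puncturedSphere n, height θ'' = height θ' ∧ OnCommonPolarGeodesic θ θ'' := by
  rw [mem_puncturedSphere_iff_height] at hθ'
  obtain ⟨θ'', h1, h2⟩ := exists_onCommonPolarGeodesic hθ hθ'.le
  exact ⟨θ'', by rwa [mem_puncturedSphere_iff_height, h1], h1, h2⟩

/-- By rotational symmetry `θ'` may be replaced by a point of the same height on the meridian of
`θ`, where (g5) applies. If the height of `θ'` is zero, so is that of `θ`, and symmetry alone gives
equality. -/
theorem reaction_le_of_height {g : UnitSphere n → ℝ → ℝ}
    (hg1 : ∀ s : ℝ, 0 < s → RotationallySymmetric (fun θ => g θ s))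
    (hg5 : MonotoneAwayFromEquator g) {θ θ' : UnitSphere n} (hθ : θ ∈ puncturedSphere n)
    (hθ' : θ' ∈ puncturedSphere n) {ν : ℝ} (hν : 1 < ν) (hh : height θ = ν * height θ') {s : ℝ}
    (hs : 0 < s) : g θ' s ≤ g θ s := by
  obtain ⟨θ'', hm, hh', hgeo⟩ := exists_meridian_point hθ hθ'
  rw [eq_of_height_eq (hg1 s hs) hm hh']
  rcases lt_trichotomy (height θ') 0 with h | h | h
  · exact (hg5 s hs θ hθ θ'' hm hgeo).2 (by rwa [hh']) (by rw [hh', hh]; nlinarith)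
  · rw [h, mul_zero] at hh
    exact (eq_of_height_eq (hg1 s hs) hθ (by rw [hh', h, hh])).le
  · exact (hg5 s hs θ hθ θ'' hm hgeo).1 (by rwa [hh']) (by rw [hh', hh]; nlinarith)

theorem reaction_lt_of_height {g : UnitSphere n → ℝ → ℝ}
    (hg1 : ∀ s : ℝ, 0 < s → RotationallySymmetric (fun θ => g θ s))
    (hg5 : StrictMonotoneAwayFromEquator g) {θ θ' : UnitSphere n} (hθ : θ ∈ puncturedSphere n)
    (hθ' : θ' ∈ puncturedSphere n) {ν : ℝ} (hν : 1 < ν) (hh : height θ = ν * height θ')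
    (h0 : height θ ≠ 0) {s : ℝ} (hs : 0 < s) : g θ' s < g θ s := by
  obtain ⟨θ'', hm, hh', hgeo⟩ := exists_meridian_point hθ hθ'
  rw [eq_of_height_eq (hg1 s hs) hm hh']
  rcases lt_trichotomy (height θ') 0 with h | h | h
  · exact (hg5 s hs θ hθ θ'' hm hgeo).2 (by rwa [hh']) (by rw [hh', hh]; nlinarith)
  · rw [h, mul_zero] at hh
    exact absurd hh h0
  · exact (hg5 s hs θ hθ θ'' hm hgeo).1 (by rwa [hh']) (by rw [hh', hh]; nlinarith)

theorem conformalWeight_neg (hn : 3 ≤ n) : conformalWeight n < 0 := by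
  have : (3 : ℝ) ≤ n := by exact_mod_cast hn
  rw [conformalWeight]
  linarith

/-- The effect on `g` of a change of conformal factor. -/
theorem rpow_mul_reaction_eq (hn : 3 ≤ n) {g : UnitSphere n → ℝ → ℝ} {θ : UnitSphere n}
    {ν s : ℝ} (hν : 0 < ν) (hs : 0 < s) :
    ν ^ (conformalWeight n - 2) * g θ (ν ^ (-conformalWeight n) * s) =
      s ^ (((n : ℝ) + 2) / ((n : ℝ) - 2)) *
        criticalQuotient g θ (ν ^ (-conformalWeight n) * s) := by
  have hn' : (3 : ℝ) ≤ n := by exact_mod_cast hn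
  set p := ((n : ℝ) + 2) / ((n : ℝ) - 2) with hp
  -- This is where the critical exponent is matched to the conformal weight: both sides equal `-(n +
  -- 2) / 2`.
  have hkp : -conformalWeight n * -p = conformalWeight n - 2 := by
    have : (n : ℝ) - 2 ≠ 0 := by linarith
    rw [conformalWeight, hp]
    field_simp
    ring
  have h1 : s ^ p * s ^ (-p) = 1 := by
    rw [← Real.rpow_add hs]
    simp
  rw [criticalQuotient, ← hp, Real.mul_rpow (Real.rpow_nonneg hν.le _) hs.le, ← Real.rpow_mul hν.le,
    hkp]
  linear_combination -ν ^ (conformalWeight n - 2) * g θ (ν ^ (-conformalWeight n) * s) * h1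

theorem reaction_eq_rpow_mul (g : UnitSphere n → ℝ → ℝ) (θ : UnitSphere n) {s : ℝ} (hs : 0 < s) :
    g θ s = s ^ (((n : ℝ) + 2) / ((n : ℝ) - 2)) * criticalQuotient g θ s := by
  rw [criticalQuotient, ← mul_assoc, ← Real.rpow_add hs]
  simp

theorem rpow_mul_reaction_le (hn : 3 ≤ n) {g : UnitSphere n → ℝ → ℝ} {θ : UnitSphere n}
    (hg3 : AntitoneOn (criticalQuotient g θ) (Set.Ioi 0)) {ν s : ℝ} (hν : 1 ≤ ν) (hs : 0 < s) :
    ν ^ (conformalWeight n - 2) * g θ (ν ^ (-conformalWeight n) * s) ≤ g θ s := by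
  have hν0 : 0 < ν := by linarith
  rw [rpow_mul_reaction_eq hn hν0 hs, reaction_eq_rpow_mul g θ hs]
  refine mul_le_mul_of_nonneg_left (hg3 hs ?_ ?_) (Real.rpow_nonneg hs.le _)
  · exact mul_pos (Real.rpow_pos_of_pos hν0 _) hs
  · have := Real.one_le_rpow hν (neg_pos.mpr (conformalWeight_neg hn)).le
    nlinarith

theorem rpow_mul_reaction_lt (hn : 3 ≤ n) {g : UnitSphere n → ℝ → ℝ} {θ : UnitSphere n}
    (hg3 : StrictAntiOn (criticalQuotient g θ) (Set.Ioi 0)) {ν s : ℝ} (hν : 1 < ν) (hs : 0 < s) :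
    ν ^ (conformalWeight n - 2) * g θ (ν ^ (-conformalWeight n) * s) < g θ s := by
  have hν0 : 0 < ν := by linarith
  rw [rpow_mul_reaction_eq hn hν0 hs, reaction_eq_rpow_mul g θ hs]
  refine mul_lt_mul_of_pos_left (hg3 hs ?_ ?_) (Real.rpow_pos_of_pos hs _)
  · exact mul_pos (Real.rpow_pos_of_pos hν0 _) hs
  · have := Real.one_lt_rpow hν (neg_pos.mpr (conformalWeight_neg hn))
    nlinarith

/-- The one-sided Lipschitz bound that follows from the monotonicity of `s ^ (-p) * g (θ, s)`. -/
theorem sub_le_reaction (hn : 3 ≤ n) {g : UnitSphere n → ℝ → ℝ} {θ : UnitSphere n}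
    (hg3 : AntitoneOn (criticalQuotient g θ) (Set.Ioi 0)) {a s H C : ℝ} (ha : 0 < a) (has : a < s)
    (hH : H ≤ g θ s) (hC : 0 ≤ C) (hHC : H ≤ C * s) :
    H - ((n : ℝ) + 2) / ((n : ℝ) - 2) * C * (s - a) ≤ g θ a := by
  have hn' : (3 : ℝ) ≤ n := by exact_mod_cast hn
  have hs : 0 < s := ha.trans has
  set p := ((n : ℝ) + 2) / ((n : ℝ) - 2) with hp
  have hp1 : 1 ≤ p := by
    rw [hp, le_div_iff₀ (by linarith)]
    linarith
  set τ := a / s with hτ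
  have hτ0 : 0 < τ := div_pos ha hs
  have hτ1 : τ < 1 := (div_lt_one hs).mpr has
  have h1 : τ ^ p * H ≤ g θ a := by
    have h2 := hg3 (Set.mem_Ioi.mpr ha) (Set.mem_Ioi.mpr hs) has.le
    have h3 : τ ^ p * g θ s ≤ g θ a := by
      rw [reaction_eq_rpow_mul g θ hs, reaction_eq_rpow_mul g θ ha, ← hp, hτ,
        Real.div_rpow ha.le hs.le, ← mul_assoc, div_mul_cancel₀ _ (Real.rpow_pos_of_pos hs _).ne']
      exact mul_le_mul_of_nonneg_left h2 (Real.rpow_nonneg ha.le _)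
    exact (mul_le_mul_of_nonneg_left hH (Real.rpow_nonneg hτ0.le _)).trans h3
  refine le_trans ?_ h1
  -- Bernoulli's inequality gives `1 - τ ^ p ≤ p (1 - τ)`. No sign of `H` is needed, since only its
  -- upper bound `C * s` is multiplied by `1 - τ ^ p`.
  have hb := one_add_mul_self_le_rpow_one_add (s := τ - 1) (by linarith) hp1
  have hle : τ ^ p ≤ 1 := Real.rpow_le_one hτ0.le hτ1.le (by linarith)
  rw [add_sub_cancel] at hb
  have hsa : s - a = (1 - τ) * s := by
    rw [hτ]
    field_simp
  rw [hsa]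
  have h4 : (1 - τ ^ p) * H ≤ (1 - τ ^ p) * (C * s) :=
    mul_le_mul_of_nonneg_left hHC (by linarith)
  have h5 : (1 - τ ^ p) * (C * s) ≤ p * (1 - τ) * (C * s) :=
    mul_le_mul_of_nonneg_right (by linarith) (by positivity)
  linarith

end Reaction

/-- Take `m = -min (w / ψ)`. A point where `w` is negative gives a positive lower bound for `m`. -/
theorem exists_touching_multiple {X : Type*} [TopologicalSpace X] {A : Set X} (hA : IsCompact A)
    {w ψ : X → ℝ} (hw : ContinuousOn w A) (hψ : ContinuousOn ψ A) (hpos : ∀ x ∈ A, 0 < ψ x)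
    {x₁ : X} (hx₁ : x₁ ∈ A) :
    ∃ x₀ ∈ A, ∃ m : ℝ, -w x₁ / ψ x₁ ≤ m ∧ w x₀ + m * ψ x₀ = 0 ∧ ∀ x ∈ A, 0 ≤ w x + m * ψ x := by
  obtain ⟨x₀, hx₀, hmin⟩ := hA.exists_isMinOn ⟨x₁, hx₁⟩
    (hw.div hψ fun x hx => (hpos x hx).ne')
  refine ⟨x₀, hx₀, -w x₀ / ψ x₀, ?_, ?_, fun x hx => ?_⟩
  · have := hmin hx₁
    simp only [Set.mem_ofPred_eq, Pi.div_apply] at this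
    rw [neg_div, neg_div]
    linarith
  · have := (hpos x₀ hx₀).ne'
    field_simp
    ring
  · have h1 := hmin hx
    simp only [Set.mem_ofPred_eq, Pi.div_apply] at h1
    have h2 := hpos x hx
    rw [le_div_iff₀ h2] at h1
    have h3 : -w x₀ / ψ x₀ * ψ x = -(w x₀ / ψ x₀ * ψ x) := by ring
    linarith

/-! ### The reflected function as a subsolution -/

section Reflection

variable {n : ℕ}

open Laplacian Filter
open scoped InnerProductSpace

/-- The pullback of `v` under the conformal reflection in the boundary of the cap
`{⟪θ, e⟫ ≥ T}`, multiplied by the conformal factor. -/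
noncomputable def reflected (v : UnitSphere n → ℝ) (e : EuclideanSpace ℝ (Fin (n + 1))) (T : ℝ)
    (θ : UnitSphere n) : ℝ :=
  conformalExt v (lorentz e T θ.1)

/-- Outside of the cap, `v` is at least its reflection. -/
def DominatesReflected (v : UnitSphere n → ℝ) (e : EuclideanSpace ℝ (Fin (n + 1))) (T : ℝ) : Prop :=
  ∀ θ ∈ puncturedSphere n, ⟪θ.1, e⟫_ℝ < T → reflected v e T θ ≤ v θ

/-- Continuity is joint in the cap parameter and the point, so that strict inequalities on compact
sets survive small changes of `T`. -/
theorem continuousAt_reflected {v : UnitSphere n → ℝ}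
    (hv : ContMDiffOn (𝓡 n) 𝓘(ℝ, ℝ) 2 v (puncturedSphere n))
    {e : EuclideanSpace ℝ (Fin (n + 1))} {T : ℝ} (hT : 1 - T ^ 2 ≠ 0) {θ : UnitSphere n}
    (hY : lorentz e T θ.1 ∈ offAxis n) :
    ContinuousAt (fun q : ℝ × UnitSphere n => reflected v e q.1 q.2) (T, θ) := by
  have h1 : ContinuousAt (fun q : ℝ × UnitSphere n => lorentz e q.1 q.2.1) (T, θ) := by
    unfold lorentz
    have h2 : ContinuousAt (fun q : ℝ × UnitSphere n => 2 / (1 - q.1 ^ 2)) (T, θ) :=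
      continuousAt_const.div (by fun_prop) hT
    have h3 : Continuous (fun q : ℝ × UnitSphere n => q.1 * ‖q.2.1‖ - ⟪q.2.1, e⟫_ℝ) := by
      fun_prop
    have h4 : Continuous (fun q : ℝ × UnitSphere n => q.2.1) := by fun_prop
    exact h4.continuousAt.add ((h2.mul h3.continuousAt).smul continuousAt_const)
  exact ContinuousAt.comp (g := conformalExt v) (contDiffAt_conformalExt hv hY).continuousAt h1

variable {e : EuclideanSpace ℝ (Fin (n + 1))} {T : ℝ}

theorem reflected_eq_self (v : UnitSphere n → ℝ) {θ : UnitSphere n} (ht : ⟪θ.1, e⟫_ℝ = T) :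
    reflected v e T θ = v θ := by
  rw [reflected, lorentz_eq_self (norm_coe_unitSphere θ) ht, conformalExt_coe]

theorem lorentz_mem_offAxis (he : ‖e‖ = 1) (heN : ⟪e, (northPole n).1⟫_ℝ = 0)
    (hT : T ∈ Set.Ico 0 1) {θ : UnitSphere n} (ht : ⟪θ.1, e⟫_ℝ < T) :
    lorentz e T θ.1 ∈ offAxis n :=
  mem_offAxis_of_inner_ne_zero heN (inner_lorentz_pos (norm_coe_unitSphere θ) he hT ht).ne'

theorem lorentz_mem_offAxis' (he : ‖e‖ = 1) (heN : ⟪e, (northPole n).1⟫_ℝ = 0)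
    (hT : T ∈ Set.Ico 0 1) {θ : UnitSphere n} (hθ : θ ∈ puncturedSphere n)
    (ht : ⟪θ.1, e⟫_ℝ ≤ T) : lorentz e T θ.1 ∈ offAxis n := by
  rcases ht.lt_or_eq with h | h
  · exact lorentz_mem_offAxis he heN hT h
  · rw [lorentz_eq_self (norm_coe_unitSphere θ) h]
    exact (mem_puncturedSphere_iff θ).mp hθ

/-- The image of a point under the conformal reflection. -/
theorem exists_reflected_point (he : ‖e‖ = 1) (heN : ⟪e, (northPole n).1⟫_ℝ = 0)
    (hT : T ∈ Set.Ioo 0 1) {θ : UnitSphere n} (ht : ⟪θ.1, e⟫_ℝ < T) (v : UnitSphere n → ℝ) :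
    ∃ θ' ∈ puncturedSphere n, T ≤ ⟪θ'.1, e⟫_ℝ ∧ height θ = ‖lorentz e T θ.1‖ * height θ' ∧
      reflected v e T θ = ‖lorentz e T θ.1‖ ^ conformalWeight n * v θ' ∧
      ∀ g : UnitSphere n → ℝ → ℝ, IsPositiveSolution g v →
        -Δ (conformalExt v) (lorentz e T θ.1) =
          ‖lorentz e T θ.1‖ ^ (conformalWeight n - 2) * g θ' (v θ') := by
  have hT' : T ∈ Set.Ico 0 1 := ⟨hT.1.le, hT.2⟩
  have hθ1 := norm_coe_unitSphere θ
  have hY := lorentz_mem_offAxis he heN hT' ht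
  have hY0 := ne_zero_of_mem_offAxis hY
  have hν : 0 < ‖lorentz e T θ.1‖ := norm_pos_iff.mpr hY0
  have hm := radialProj_mem_puncturedSphere hY
  refine ⟨radialProj _ hY0, hm, ?_, ?_, conformalExt_eq v hY0, fun g hv => ?_⟩
  · rw [radialProj, real_inner_smul_left, inner_lorentz hθ1 he hT', inv_mul_eq_div,
      le_div_iff₀ hν]
    linarith
  · rw [height_eq_inner, height_eq_inner, radialProj, real_inner_smul_left,
      inner_lorentz_of_orthogonal heN, mul_inv_cancel_left₀ hν.ne']
  · rw [laplacian_conformalExt hv.contMDiffOn hY, ← hv.equation _ hm]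
    ring

theorem reflected_pos (he : ‖e‖ = 1) (heN : ⟪e, (northPole n).1⟫_ℝ = 0) (hT : T ∈ Set.Ioo 0 1)
    {θ : UnitSphere n} (ht : ⟪θ.1, e⟫_ℝ < T) {v : UnitSphere n → ℝ}
    (hv : ∀ θ ∈ puncturedSphere n, 0 < v θ) : 0 < reflected v e T θ := by
  obtain ⟨θ', hm, -, -, h, -⟩ := exists_reflected_point he heN hT ht v
  have h1 := one_lt_norm_lorentz (norm_coe_unitSphere θ) he hT ht
  rw [h]
  exact mul_pos (Real.rpow_pos_of_pos (by linarith) _) (hv θ' hm)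

/-- Two effects of `ν > 1` have the same sign: the conformal factor lowers the reaction by (g3), and
moving from `θ'` back to `θ`, away from the equator, raises it by (g5). -/
theorem laplacian_conformalExt_lorentz_le (hn : 3 ≤ n) {g : UnitSphere n → ℝ → ℝ}
    (hg1 : ∀ s : ℝ, 0 < s → RotationallySymmetric (fun θ => g θ s))
    (hg3 : ∀ θ ∈ puncturedSphere n, AntitoneOn (criticalQuotient g θ) (Set.Ioi (0 : ℝ)))
    (hg5 : MonotoneAwayFromEquator g) {v : UnitSphere n → ℝ} (hv : IsPositiveSolution g v)
    (he : ‖e‖ = 1) (heN : ⟪e, (northPole n).1⟫_ℝ = 0) (hT : T ∈ Set.Ioo 0 1) {θ : UnitSphere n}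
    (hθ : θ ∈ puncturedSphere n) (ht : ⟪θ.1, e⟫_ℝ < T) :
    -Δ (conformalExt v) (lorentz e T θ.1) ≤ g θ (reflected v e T θ) := by
  obtain ⟨θ', hm, -, hh, h, hΔ⟩ := exists_reflected_point he heN hT ht v
  have hν := one_lt_norm_lorentz (norm_coe_unitSphere θ) he hT ht
  have hs := reflected_pos he heN hT ht hv.pos
  set ν := ‖lorentz e T θ.1‖
  have hvθ' : v θ' = ν ^ (-conformalWeight n) * reflected v e T θ := by
    rw [h, ← mul_assoc, ← Real.rpow_add (by linarith)]
    simp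
  rw [hΔ g hv, hvθ']
  exact (rpow_mul_reaction_le hn (hg3 θ' hm) hν.le hs).trans
    (reaction_le_of_height hg1 hg5 hθ hm hν hh hs)

/-- Either alternative of (g6) makes one of the two inequalities strict; the height must be nonzero
because (g5) compares nothing on the equator. -/
theorem laplacian_conformalExt_lorentz_lt (hn : 3 ≤ n) {g : UnitSphere n → ℝ → ℝ}
    (hg1 : ∀ s : ℝ, 0 < s → RotationallySymmetric (fun θ => g θ s))
    (hg3 : ∀ θ ∈ puncturedSphere n, AntitoneOn (criticalQuotient g θ) (Set.Ioi (0 : ℝ)))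
    (hg5 : MonotoneAwayFromEquator g)
    (hg6 : StrictMonotoneAwayFromEquator g ∨
      ∀ θ ∈ puncturedSphere n, StrictAntiOn (criticalQuotient g θ) (Set.Ioi (0 : ℝ)))
    {v : UnitSphere n → ℝ} (hv : IsPositiveSolution g v)
    (he : ‖e‖ = 1) (heN : ⟪e, (northPole n).1⟫_ℝ = 0) (hT : T ∈ Set.Ioo 0 1) {θ : UnitSphere n}
    (hθ : θ ∈ puncturedSphere n) (ht : ⟪θ.1, e⟫_ℝ < T) (h0 : height θ ≠ 0) :
    -Δ (conformalExt v) (lorentz e T θ.1) < g θ (reflected v e T θ) := by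
  obtain ⟨θ', hm, -, hh, h, hΔ⟩ := exists_reflected_point he heN hT ht v
  have hν := one_lt_norm_lorentz (norm_coe_unitSphere θ) he hT ht
  have hs := reflected_pos he heN hT ht hv.pos
  set ν := ‖lorentz e T θ.1‖
  have hvθ' : v θ' = ν ^ (-conformalWeight n) * reflected v e T θ := by
    rw [h, ← mul_assoc, ← Real.rpow_add (by linarith)]
    simp
  rw [hΔ g hv, hvθ']
  rcases hg6 with hg6 | hg6
  · exact (rpow_mul_reaction_le hn (hg3 θ' hm) hν.le hs).trans_lt
      (reaction_lt_of_height hg1 hg6 hθ hm hν hh h0 hs)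
  · exact (rpow_mul_reaction_lt hn (hg6 θ' hm) hν hs).trans_le
      (reaction_le_of_height hg1 hg5 hθ hm hν hh hs)

/-- A weak form of the strong maximum principle: off the equator there is no interior touching. -/
theorem DominatesReflected.lt (hn : 3 ≤ n) {g : UnitSphere n → ℝ → ℝ}
    (hg1 : ∀ s : ℝ, 0 < s → RotationallySymmetric (fun θ => g θ s))
    (hg3 : ∀ θ ∈ puncturedSphere n, AntitoneOn (criticalQuotient g θ) (Set.Ioi (0 : ℝ)))
    (hg5 : MonotoneAwayFromEquator g)
    (hg6 : StrictMonotoneAwayFromEquator g ∨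
      ∀ θ ∈ puncturedSphere n, StrictAntiOn (criticalQuotient g θ) (Set.Ioi (0 : ℝ)))
    {v : UnitSphere n → ℝ} (hv : IsPositiveSolution g v)
    (he : ‖e‖ = 1) (heN : ⟪e, (northPole n).1⟫_ℝ = 0) (hT : T ∈ Set.Ioo 0 1)
    (hdom : DominatesReflected v e T) {θ : UnitSphere n}
    (hθ : θ ∈ puncturedSphere n) (ht : ⟪θ.1, e⟫_ℝ < T) (h0 : height θ ≠ 0) :
    reflected v e T θ < v θ := by
  refine lt_of_le_of_ne (hdom θ hθ ht) fun heq => ?_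
  have hT' : T ∈ Set.Ico 0 1 := ⟨hT.1.le, hT.2⟩
  have h1 := reaction_le_of_local_min hv he hT' hθ (lorentz_mem_offAxis he heN hT' ht)
    (Ψ := fun _ => 0) contDiffAt_const (fun _ _ _ _ => by simp) ?_ ?_
  · have h2 := laplacian_conformalExt_lorentz_lt hn hg1 hg3 hg5 hg6 hv he heN hT hθ ht h0
    rw [heq] at h2
    rw [InnerProductSpace.laplacian_const] at h1
    simp only [Pi.zero_apply, add_zero] at h1
    linarith
  · have hopen : IsOpen {θ : UnitSphere n | ⟪θ.1, e⟫_ℝ < T} :=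
      isOpen_lt (by fun_prop) continuous_const
    filter_upwards [isOpen_puncturedSphere.mem_nhds hθ, hopen.mem_nhds ht] with θ' hm ht'
    have := hdom θ' hm ht'
    rw [reflected] at this
    linarith
  · rw [reflected] at heq
    linarith

/-- At a negative interior minimum, a barrier is not a strict supersolution. -/
theorem laplacian_barrier_nonneg (hn : 3 ≤ n) {g : UnitSphere n → ℝ → ℝ}
    (hg1 : ∀ s : ℝ, 0 < s → RotationallySymmetric (fun θ => g θ s))
    (hg3 : ∀ θ ∈ puncturedSphere n, AntitoneOn (criticalQuotient g θ) (Set.Ioi (0 : ℝ)))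
    (hg5 : MonotoneAwayFromEquator g) {v : UnitSphere n → ℝ} (hv : IsPositiveSolution g v)
    (he : ‖e‖ = 1) (heN : ⟪e, (northPole n).1⟫_ℝ = 0) (hT : T ∈ Set.Ioo 0 1)
    {C : ℝ} (hC : 0 ≤ C) (hgC : ∀ θ ∈ puncturedSphere n, T ≤ ⟪θ.1, e⟫_ℝ → g θ (v θ) ≤ C * v θ)
    {θ : UnitSphere n} (hθ : θ ∈ puncturedSphere n) (ht : ⟪θ.1, e⟫_ℝ < T)
    {ψ : EuclideanSpace ℝ (Fin (n + 1)) → ℝ} (hψ : ContDiffAt ℝ 2 ψ θ.1)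
    (hom : ∀ y, y ≠ 0 → ∀ t : ℝ, 0 < t → ψ (t • y) = t ^ conformalWeight n * ψ y)
    {m : ℝ} (hm : 0 < m) (hψθ : 0 < ψ θ.1)
    (hmin : ∀ᶠ θ' in 𝓝 θ, 0 ≤ v θ' - reflected v e T θ' + m * ψ θ'.1)
    (heq : v θ - reflected v e T θ + m * ψ θ.1 = 0) :
    0 ≤ Δ ψ θ.1 + ((n : ℝ) + 2) / ((n : ℝ) - 2) * C * ψ θ.1 := by
  have hT' : T ∈ Set.Ico 0 1 := ⟨hT.1.le, hT.2⟩
  have h1 := reaction_le_of_local_min hv he hT' hθ (lorentz_mem_offAxis he heN hT' ht)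
    (Ψ := m • ψ) (contDiffAt_const.smul hψ)
    (fun y hy t ht => by simp only [Pi.smul_apply, smul_eq_mul, hom y hy t ht]; ring) hmin heq
  rw [InnerProductSpace.laplacian_smul _ hψ, smul_eq_mul] at h1
  have h2 := laplacian_conformalExt_lorentz_le hn hg1 hg3 hg5 hv he heN hT hθ ht
  have hmψ : 0 < m * ψ θ.1 := mul_pos hm hψθ
  -- The linear upper bound required by `sub_le_reaction`. It comes from the cap, where the
  -- reflected point lies, and the factor `ν ^ (-2) ≤ 1` is discarded.
  have h3 : -Δ (conformalExt v) (lorentz e T θ.1) ≤ C * reflected v e T θ := by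
    obtain ⟨θ', hm', ht', -, hr, hΔ⟩ := exists_reflected_point he heN hT ht v
    have hν := one_lt_norm_lorentz (norm_coe_unitSphere θ) he hT ht
    have hs := reflected_pos he heN hT ht hv.pos
    set ν := ‖lorentz e T θ.1‖
    have hν0 : 0 < ν := by linarith
    have hsub : ν ^ (conformalWeight n - 2) ≤ ν ^ conformalWeight n :=
      Real.rpow_le_rpow_of_exponent_le hν.le (by linarith)
    calc _ = ν ^ (conformalWeight n - 2) * g θ' (v θ') := hΔ g hv
      _ ≤ ν ^ (conformalWeight n - 2) * (C * v θ') :=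
        mul_le_mul_of_nonneg_left (hgC θ' hm' ht') (Real.rpow_nonneg hν0.le _)
      _ ≤ ν ^ conformalWeight n * (C * v θ') :=
        mul_le_mul_of_nonneg_right hsub (mul_nonneg hC (hv.pos θ' hm').le)
      _ = C * reflected v e T θ := by
        rw [hr]
        ring
  have h4 := sub_le_reaction hn (hg3 θ hθ) (hv.pos θ hθ)
    (show v θ < reflected v e T θ by linarith) h2 hC h3
  have h5 : reflected v e T θ - v θ = m * ψ θ.1 := by linarith
  rw [h5] at h4
  have h6 : 0 ≤ m * (Δ ψ θ.1 + ((n : ℝ) + 2) / ((n : ℝ) - 2) * C * ψ θ.1) := by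
    linear_combination h1 + h4
  exact nonneg_of_mul_nonneg_right h6 hm

end Reflection

/-! ### Construction of the barriers -/

section Barrier

open Laplacian Filter
open scoped InnerProductSpace

theorem sq_add_sq_pos {δ : ℝ} (hδ : 0 < δ) (s : ℝ) : 0 < s ^ 2 + δ ^ 2 := by positivity

theorem hasDerivAt_neg_sqrt {δ : ℝ} (hδ : 0 < δ) (c t : ℝ) :
    HasDerivAt (fun t => -√((t - c) ^ 2 + δ ^ 2)) (-((t - c) / √((t - c) ^ 2 + δ ^ 2))) t := by
  have h0 := sq_add_sq_pos hδ (t - c)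
  have h1 : HasDerivAt (fun t => (t - c) ^ 2 + δ ^ 2) (2 * (t - c)) t := by
    simpa using (((hasDerivAt_id t).sub_const c).pow 2).add_const (δ ^ 2)
  convert! (h1.sqrt h0.ne').neg using 1
  field_simp

theorem hasDerivAt_neg_sub_div_sqrt {δ : ℝ} (hδ : 0 < δ) (c t : ℝ) :
    HasDerivAt (fun t => -((t - c) / √((t - c) ^ 2 + δ ^ 2)))
      (-(δ ^ 2 / √((t - c) ^ 2 + δ ^ 2) ^ 3)) t := by
  have h0 := sq_add_sq_pos hδ (t - c)
  have h1 := (hasDerivAt_neg_sqrt hδ c t).neg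
  simp only [neg_neg] at h1
  have h2 := (((hasDerivAt_id t).sub_const c).div h1 (by simpa using (Real.sqrt_pos.mpr h0).ne')).neg
  convert! h2 using 1
  · ext y
    simp
  · have h3 := Real.sqrt_pos.mpr h0
    have h4 := Real.sq_sqrt h0.le
    simp only [id, Pi.neg_apply, neg_neg]
    set r := √((t - c) ^ 2 + δ ^ 2)
    field_simp
    linear_combination h4

theorem contDiff_neg_sqrt {δ : ℝ} (hδ : 0 < δ) (c : ℝ) :
    ContDiff ℝ 2 (fun t => -√((t - c) ^ 2 + δ ^ 2)) :=
  ((((contDiff_id.sub contDiff_const).pow 2).add contDiff_const).sqrt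
    fun t => (sq_add_sq_pos hδ (t - c)).ne').neg

/-- Concavity gives the second-order term a favourable sign, and the slope is at most 1 in absolute
value, so the drift costs at most `d`. -/
theorem neg_sqrt_operator_le {δ : ℝ} (hδ : 0 < δ) (c : ℝ) {t d : ℝ} (hd : 0 ≤ d) (ht : |t| ≤ 1) :
    (1 - t ^ 2) * -(δ ^ 2 / √((t - c) ^ 2 + δ ^ 2) ^ 3) -
      d * t * -((t - c) / √((t - c) ^ 2 + δ ^ 2)) ≤ d := by
  have h0 := sq_add_sq_pos hδ (t - c)
  have h3 := Real.sqrt_pos.mpr h0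
  have hle : |(t - c) / √((t - c) ^ 2 + δ ^ 2)| ≤ 1 := by
    rw [abs_div, abs_of_pos h3, div_le_one h3]
    exact Real.abs_le_sqrt (by nlinarith)
  set r := √((t - c) ^ 2 + δ ^ 2)
  have h1 : 0 ≤ (1 - t ^ 2) * (δ ^ 2 / r ^ 3) :=
    mul_nonneg (sub_nonneg.mpr ((sq_le_one_iff_abs_le_one t).mpr ht)) (by positivity)
  have h2 : t * ((t - c) / r) ≤ 1 := by
    refine (le_abs_self _).trans ?_
    rw [abs_mul]
    exact mul_le_one₀ ht (abs_nonneg _) hle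
  nlinarith

/-- Within distance `δ` of `c` the root satisfies `r ^ 2 ≤ 2 δ ^ 2`, hence `r ^ 3 ≤ 3 δ ^ 3`, and
the second derivative is at most `-1 / (3 δ)`: a small `δ` buys arbitrarily strong concavity. -/
theorem neg_sqrt_operator_le_of_near {δ : ℝ} (hδ : 0 < δ) {c t d : ℝ} (hd : 0 ≤ d) (ht : |t| ≤ 1)
    (htc : |t - c| ≤ δ) :
    (1 - t ^ 2) * -(δ ^ 2 / √((t - c) ^ 2 + δ ^ 2) ^ 3) -
      d * t * -((t - c) / √((t - c) ^ 2 + δ ^ 2)) ≤ d - (1 - t ^ 2) / (3 * δ) := by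
  have h0 := sq_add_sq_pos hδ (t - c)
  have h3 := Real.sqrt_pos.mpr h0
  have h4 := Real.sq_sqrt h0.le
  have hle : |(t - c) / √((t - c) ^ 2 + δ ^ 2)| ≤ 1 := by
    rw [abs_div, abs_of_pos h3, div_le_one h3]
    exact Real.abs_le_sqrt (by nlinarith)
  set r := √((t - c) ^ 2 + δ ^ 2)
  have hr2 : r ^ 2 ≤ 2 * δ ^ 2 := by
    have := sq_le_sq' (by linarith [neg_abs_le (t - c)]) ((le_abs_self _).trans htc)
    linarith
  have hr1 : r ≤ 3 / 2 * δ := by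
    refine le_of_sq_le_sq ?_ (by positivity)
    nlinarith
  have hr3 : r ^ 3 ≤ 3 * δ ^ 3 := by
    calc r ^ 3 = r ^ 2 * r := by ring
      _ ≤ 2 * δ ^ 2 * (3 / 2 * δ) := by gcongr
      _ = 3 * δ ^ 3 := by ring
  have h5 : 1 / (3 * δ) ≤ δ ^ 2 / r ^ 3 := by
    rw [div_le_div_iff₀ (by positivity) (by positivity)]
    nlinarith
  have h1 : (1 - t ^ 2) * (1 / (3 * δ)) ≤ (1 - t ^ 2) * (δ ^ 2 / r ^ 3) :=
    mul_le_mul_of_nonneg_left h5 (sub_nonneg.mpr ((sq_le_one_iff_abs_le_one t).mpr ht))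
  have h2 : t * ((t - c) / r) ≤ 1 := by
    refine (le_abs_self _).trans ?_
    rw [abs_mul]
    exact mul_le_one₀ ht (abs_nonneg _) hle
  rw [mul_one_div] at h1
  nlinarith

theorem hasDerivAt_one_sub_sq (z : ℝ) : HasDerivAt (fun z : ℝ => 1 - z ^ 2) (-(2 * z)) z := by
  simpa using ((hasDerivAt_id z).pow 2).const_sub 1

theorem hasDerivAt_rpow_one_sub_sq (a : ℝ) {z : ℝ} (hz : 0 < 1 - z ^ 2) :
    HasDerivAt (fun z : ℝ => (1 - z ^ 2) ^ a) (-(2 * z) * a * (1 - z ^ 2) ^ (a - 1)) z :=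
  (hasDerivAt_one_sub_sq z).rpow_const (Or.inl hz.ne')

/-- Equality holds for `d = 3`, and a larger `d` only lowers the left side. The power `-1/4` blows
up at the poles slowly enough to be superharmonic there in every dimension `n ≥ 3`. -/
theorem polar_operator_le {d z : ℝ} (hd : 3 ≤ d) (hz : 0 < 1 - z ^ 2) :
    (1 - z ^ 2) * (1 / 2 * (1 - z ^ 2) ^ (-(5 / 4) : ℝ) +
      z / 2 * (-(2 * z) * (-(5 / 4)) * (1 - z ^ 2) ^ (-(5 / 4) - 1 : ℝ))) -
      d * z * (z / 2 * (1 - z ^ 2) ^ (-(5 / 4) : ℝ)) ≤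
    3 / 4 * (1 - z ^ 2) ^ (-(1 / 4) : ℝ) - 1 / 4 * ((1 - z ^ 2) ^ (-(1 / 4) : ℝ)) ^ 5 := by
  have h5 : ((1 - z ^ 2) ^ (-(1 / 4) : ℝ)) ^ 5 = (1 - z ^ 2) ^ (-(5 / 4) : ℝ) := by
    rw [← Real.rpow_mul_natCast hz.le]
    norm_num
  have h1 : (1 - z ^ 2) ^ (-(1 / 4) : ℝ) = (1 - z ^ 2) * (1 - z ^ 2) ^ (-(5 / 4) : ℝ) := by
    rw [show (-(1 / 4) : ℝ) = 1 + -(5 / 4) by norm_num, Real.rpow_add hz, Real.rpow_one]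
  have h9 : (1 - z ^ 2) ^ (-(5 / 4) : ℝ) = (1 - z ^ 2) * (1 - z ^ 2) ^ (-(5 / 4) - 1 : ℝ) := by
    rw [show (-(5 / 4) : ℝ) = 1 + (-(5 / 4) - 1) by norm_num, Real.rpow_add hz, Real.rpow_one]
    norm_num
  rw [h5, h1]
  have hQ : 0 ≤ (1 - z ^ 2) ^ (-(5 / 4) : ℝ) := Real.rpow_nonneg hz.le _
  set Q := (1 - z ^ 2) ^ (-(5 / 4) : ℝ)
  set R := (1 - z ^ 2) ^ (-(5 / 4) - 1 : ℝ)
  have h6 : 0 ≤ (d - 3) * (z ^ 2 * Q) := mul_nonneg (by linarith) (by positivity)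
  linear_combination 1 / 2 * h6 - 5 / 4 * z ^ 2 * h9

theorem quintic_le_half {P : ℝ} (hP : 1 ≤ P) : 3 / 4 * P - 1 / 4 * P ^ 5 ≤ 1 / 2 := by
  have h1 := pow_le_pow_right₀ hP (show 3 ≤ 5 by norm_num)
  have h2 : 0 ≤ (P - 1) ^ 2 * (P + 2) := mul_nonneg (sq_nonneg _) (by linarith)
  linear_combination 1 / 4 * h1 + 1 / 4 * h2

variable {n : ℕ}

theorem zonalExt_coe (k : ℝ) (f : ℝ → ℝ) (b : EuclideanSpace ℝ (Fin (n + 1))) (θ : UnitSphere n) :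
    zonalExt k f b θ.1 = f ⟪θ.1, b⟫_ℝ := by
  simp [zonalExt]

theorem zonalExt_smul (k : ℝ) (f : ℝ → ℝ) (b : EuclideanSpace ℝ (Fin (n + 1)))
    {y : EuclideanSpace ℝ (Fin (n + 1))} (hy : y ≠ 0) {t : ℝ} (ht : 0 < t) :
    zonalExt k f b (t • y) = t ^ k * zonalExt k f b y := by
  have h1 : ⟪t • y, b⟫_ℝ * ‖t • y‖ ^ (-1 : ℝ) = ⟪y, b⟫_ℝ * ‖y‖ ^ (-1 : ℝ) := by
    have : ‖y‖ ≠ 0 := norm_ne_zero_iff.mpr hy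
    rw [real_inner_smul_left, norm_smul, Real.norm_eq_abs, abs_of_pos ht, Real.rpow_neg_one,
      Real.rpow_neg_one]
    field_simp
  rw [zonalExt, zonalExt, h1, norm_smul, Real.norm_eq_abs, abs_of_pos ht,
    Real.mul_rpow ht.le (norm_nonneg y), mul_assoc]

theorem laplacian_zonalExt_coe {f f' : ℝ → ℝ} {f'' : ℝ} {b : EuclideanSpace ℝ (Fin (n + 1))}
    (hb : ‖b‖ = 1) {θ : UnitSphere n} (hf : ContDiffAt ℝ 2 f ⟪θ.1, b⟫_ℝ)
    (hf1 : ∀ᶠ s in 𝓝 ⟪θ.1, b⟫_ℝ, HasDerivAt f (f' s) s) (hf2 : HasDerivAt f' f'' ⟪θ.1, b⟫_ℝ) :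
    Δ (zonalExt (conformalWeight n) f b) θ.1 = (1 - ⟪θ.1, b⟫_ℝ ^ 2) * f'' -
      n * ⟪θ.1, b⟫_ℝ * f' ⟪θ.1, b⟫_ℝ - n * (n - 2) / 4 * f ⟪θ.1, b⟫_ℝ := by
  rw [laplacian_zonalExt _ (norm_coe_unitSphere θ) hb hf hf1 hf2, finrank_euclideanSpace,
    Fintype.card_fin, conformalWeight]
  push_cast
  ring

theorem abs_inner_le_one {b : EuclideanSpace ℝ (Fin (n + 1))} (hb : ‖b‖ = 1) (θ : UnitSphere n) :
    |⟪θ.1, b⟫_ℝ| ≤ 1 := by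
  have := abs_real_inner_le_norm θ.1 b
  rwa [hb, norm_coe_unitSphere, one_mul] at this

/-- The smooth concave profile concentrated at the hypersurface `{⟪θ, b⟫ = c}`. -/
noncomputable def stripBarrier (δ c : ℝ) (b : EuclideanSpace ℝ (Fin (n + 1))) :
    EuclideanSpace ℝ (Fin (n + 1)) → ℝ :=
  zonalExt (conformalWeight n) (fun t => -√((t - c) ^ 2 + δ ^ 2)) b

theorem laplacian_stripBarrier {δ : ℝ} (hδ : 0 < δ) (c : ℝ) {b : EuclideanSpace ℝ (Fin (n + 1))}
    (hb : ‖b‖ = 1) (θ : UnitSphere n) :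
    Δ (stripBarrier δ c b) θ.1 =
      (1 - ⟪θ.1, b⟫_ℝ ^ 2) * -(δ ^ 2 / √((⟪θ.1, b⟫_ℝ - c) ^ 2 + δ ^ 2) ^ 3) -
      n * ⟪θ.1, b⟫_ℝ * -((⟪θ.1, b⟫_ℝ - c) / √((⟪θ.1, b⟫_ℝ - c) ^ 2 + δ ^ 2)) -
      n * (n - 2) / 4 * stripBarrier δ c b θ.1 := by
  rw [stripBarrier, zonalExt_coe]
  exact laplacian_zonalExt_coe hb (contDiff_neg_sqrt hδ c).contDiffAt
    (Eventually.of_forall fun s => hasDerivAt_neg_sqrt hδ c s) (hasDerivAt_neg_sub_div_sqrt hδ c _)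

theorem stripBarrier_nonpos (δ c : ℝ) (b : EuclideanSpace ℝ (Fin (n + 1))) (θ : UnitSphere n) :
    stripBarrier δ c b θ.1 ≤ 0 := by
  rw [stripBarrier, zonalExt_coe]
  exact neg_nonpos.mpr (Real.sqrt_nonneg _)

theorem neg_three_le_stripBarrier {δ c : ℝ} (hδ : |δ| ≤ 1) (hc : |c| ≤ 1)
    {b : EuclideanSpace ℝ (Fin (n + 1))} (hb : ‖b‖ = 1) (θ : UnitSphere n) :
    -3 ≤ stripBarrier δ c b θ.1 := by
  rw [stripBarrier, zonalExt_coe, neg_le_neg_iff]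
  refine Real.sqrt_le_iff.mpr ⟨by norm_num, ?_⟩
  have h1 := abs_le.mp (abs_inner_le_one hb θ)
  have h2 := abs_le.mp hc
  have h3 := (sq_le_one_iff_abs_le_one δ).mpr hδ
  nlinarith

/-- The profile that blows up at the poles. -/
noncomputable def polarBarrier (n : ℕ) : EuclideanSpace ℝ (Fin (n + 1)) → ℝ :=
  zonalExt (conformalWeight n) (fun z => 6 + (1 - z ^ 2) ^ (-(1 / 4) : ℝ)) (northPole n).1

theorem one_sub_inner_sq_pos {θ : UnitSphere n} (hθ : θ ∈ puncturedSphere n) :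
    0 < 1 - ⟪θ.1, (northPole n).1⟫_ℝ ^ 2 := by
  rw [← height_eq_inner]
  exact sub_pos.mpr ((mem_puncturedSphere_iff_height θ).mp hθ)

theorem polarBarrier_coe (θ : UnitSphere n) :
    polarBarrier n θ.1 = 6 + (1 - height θ ^ 2) ^ (-(1 / 4) : ℝ) := by
  rw [polarBarrier, zonalExt_coe, height_eq_inner]

theorem contDiffAt_polarProfile {z : ℝ} (hz : 0 < 1 - z ^ 2) :
    ContDiffAt ℝ 2 (fun z : ℝ => 6 + (1 - z ^ 2) ^ (-(1 / 4) : ℝ)) z :=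
  contDiffAt_const.add
    ((contDiffAt_const.sub (contDiffAt_id.pow 2)).rpow_const_of_ne (by simpa using hz.ne'))

theorem laplacian_polarBarrier_le (hn : 3 ≤ n) {θ : UnitSphere n} (hθ : θ ∈ puncturedSphere n) :
    Δ (polarBarrier n) θ.1 ≤ 3 / 4 * (1 - height θ ^ 2) ^ (-(1 / 4) : ℝ) -
      1 / 4 * ((1 - height θ ^ 2) ^ (-(1 / 4) : ℝ)) ^ 5 -
      n * (n - 2) / 4 * polarBarrier n θ.1 := by
  have hq := one_sub_inner_sq_pos hθ
  have hn' : (3 : ℝ) ≤ n := by exact_mod_cast hn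
  rw [height_eq_inner, polarBarrier, zonalExt_coe]
  have h1 : ∀ᶠ s in 𝓝 ⟪θ.1, (northPole n).1⟫_ℝ,
      HasDerivAt (fun z : ℝ => 6 + (1 - z ^ 2) ^ (-(1 / 4) : ℝ))
        (s / 2 * (1 - s ^ 2) ^ (-(5 / 4) : ℝ)) s := by
    have hopen : IsOpen {s : ℝ | 0 < 1 - s ^ 2} := isOpen_lt continuous_const (by fun_prop)
    filter_upwards [hopen.mem_nhds hq] with s hs
    have := (hasDerivAt_rpow_one_sub_sq (-(1 / 4)) hs).const_add 6
    convert! this using 1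
    rw [show (-(1 / 4) - 1 : ℝ) = -(5 / 4) by norm_num]
    ring
  have h2 := ((hasDerivAt_id ⟪θ.1, (northPole n).1⟫_ℝ).div_const 2).mul
    (hasDerivAt_rpow_one_sub_sq (-(5 / 4)) hq)
  rw [laplacian_zonalExt_coe norm_northPole (contDiffAt_polarProfile hq) h1 h2]
  have := polar_operator_le hn' hq
  simp only [id]
  linarith

/-- A positive function that is a strict supersolution near the poles, near the equator and near
the hypersurface `{⟪θ, e⟫ = T}`. -/
theorem exists_barrier (hn : 3 ≤ n) {e : EuclideanSpace ℝ (Fin (n + 1))} (he : ‖e‖ = 1) {T : ℝ}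
    (hT : T ∈ Set.Ioo 0 1) {C : ℝ} (hC : 0 ≤ C) :
    ∃ (ψ : EuclideanSpace ℝ (Fin (n + 1)) → ℝ) (δ r : ℝ), 0 < δ ∧ 0 < r ∧
      (∀ θ ∈ puncturedSphere n, ContDiffAt ℝ 2 ψ θ.1) ∧
      (∀ y, y ≠ 0 → ∀ t : ℝ, 0 < t → ψ (t • y) = t ^ conformalWeight n * ψ y) ∧
      (∀ θ ∈ puncturedSphere n, (1 - height θ ^ 2) ^ (-(1 / 4) : ℝ) ≤ ψ θ.1) ∧
      ∀ θ ∈ puncturedSphere n,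
        1 - height θ ^ 2 ≤ r ∨ |height θ| ≤ δ ∨ |⟪θ.1, e⟫_ℝ - T| ≤ δ →
          Δ ψ θ.1 + C * ψ θ.1 < 0 := by
  have hn' : (3 : ℝ) ≤ n := by exact_mod_cast hn
  obtain ⟨hT0, hT1⟩ := hT
  -- Threshold for the polar term. A quarter of `P₀ * P` pays for the two strip drifts (`2n`), for
  -- `C (6 + P) ≤ 7 C P`, and for the remaining `3/4 * P`.
  set P₀ : ℝ := 8 * n + 28 * C + 5 with hP₀
  have hP₀1 : 1 ≤ P₀ := by linarith
  set κ := (1 - T) / 2 with hκ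
  have hκ0 : 0 < κ := by linarith
  -- Everything that strict concavity in a strip has to beat when `P < P₀`: two drifts, the bounded
  -- polar part, and the zeroth-order term.
  set M := 2 * n + 1 / 2 + C * (6 + P₀) with hM
  have hM0 : 0 < M := by positivity
  set δ := min (min (1 / 2) T) (min κ (κ / (3 * (M + 1)))) with hδ
  have hδ0 : 0 < δ := by positivity
  have hδ1 : δ ≤ 1 / 2 := (min_le_left _ _).trans (min_le_left _ _)
  have hδ2 : δ ≤ T := (min_le_left _ _).trans (min_le_right _ _)
  have hδ3 : δ ≤ κ := (min_le_right _ _).trans (min_le_left _ _)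
  have hδ4 : M + 1 ≤ κ / (3 * δ) := by
    have : δ ≤ κ / (3 * (M + 1)) := (min_le_right _ _).trans (min_le_right _ _)
    rw [le_div_iff₀ (by positivity)] at this ⊢
    linarith
  have hδabs : |δ| ≤ 1 := by
    rw [abs_of_pos hδ0]
    linarith
  have hNN := norm_northPole (n := n)
  refine ⟨polarBarrier n + stripBarrier δ 0 (northPole n).1 + stripBarrier δ T e, δ,
    P₀ ^ (-4 : ℝ), hδ0, by positivity, fun θ hθ => ?_, fun y hy t ht => ?_, fun θ hθ => ?_,
    fun θ hθ hreg => ?_⟩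
  · exact ((contDiffAt_zonalExt _ (norm_coe_unitSphere θ)
      (contDiffAt_polarProfile (one_sub_inner_sq_pos hθ))).add
      (contDiffAt_zonalExt _ (norm_coe_unitSphere θ) (contDiff_neg_sqrt hδ0 0).contDiffAt)).add
      (contDiffAt_zonalExt _ (norm_coe_unitSphere θ) (contDiff_neg_sqrt hδ0 T).contDiffAt)
  · simp only [Pi.add_apply, polarBarrier, stripBarrier, zonalExt_smul _ _ _ hy ht]
    ring
  -- The constant 6 in the polar profile compensates the two strip profiles, each at least `-3`.
  · have h1 := neg_three_le_stripBarrier (c := 0) hδabs (by simp) hNN θ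
    have h2 := neg_three_le_stripBarrier (c := T) hδabs (abs_le.mpr ⟨by linarith, hT1.le⟩) he θ
    rw [Pi.add_apply, Pi.add_apply, polarBarrier_coe]
    linarith
  have hc1 : ContDiffAt ℝ 2 (polarBarrier n) θ.1 := contDiffAt_zonalExt _ (norm_coe_unitSphere θ)
    (contDiffAt_polarProfile (one_sub_inner_sq_pos hθ))
  have hc2 : ContDiffAt ℝ 2 (stripBarrier δ 0 (northPole n).1) θ.1 :=
    contDiffAt_zonalExt _ (norm_coe_unitSphere θ) (contDiff_neg_sqrt hδ0 0).contDiffAt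
  have hc3 : ContDiffAt ℝ 2 (stripBarrier δ T e) θ.1 :=
    contDiffAt_zonalExt _ (norm_coe_unitSphere θ) (contDiff_neg_sqrt hδ0 T).contDiffAt
  have hc12 : ContDiffAt ℝ 2 (polarBarrier n + stripBarrier δ 0 (northPole n).1) θ.1 := hc1.add hc2
  rw [hc12.laplacian_add hc3, hc1.laplacian_add hc2, Pi.add_apply, Pi.add_apply]
  have hb1 := laplacian_polarBarrier_le hn hθ
  have hb2 := laplacian_stripBarrier hδ0 0 hNN θ
  have hb3 := laplacian_stripBarrier hδ0 T he θ
  have hd : (0 : ℝ) ≤ n := by linarith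
  have ha2 := abs_inner_le_one hNN θ
  have ha3 := abs_inner_le_one he θ
  have ho2 := neg_sqrt_operator_le hδ0 0 hd ha2
  have ho3 := neg_sqrt_operator_le hδ0 T hd ha3
  have hl2 := neg_three_le_stripBarrier (c := 0) hδabs (by simp) hNN θ
  have hl3 := neg_three_le_stripBarrier (c := T) hδabs (abs_le.mpr ⟨by linarith, hT1.le⟩) he θ
  have hu2 := stripBarrier_nonpos δ 0 (northPole n).1 θ
  have hu3 := stripBarrier_nonpos δ T e θ
  have hp := polarBarrier_coe θ
  have hq : 0 < 1 - height θ ^ 2 := sub_pos.mpr ((mem_puncturedSphere_iff_height θ).mp hθ)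
  have hP1 : 1 ≤ (1 - height θ ^ 2) ^ (-(1 / 4) : ℝ) :=
    Real.one_le_rpow_of_pos_of_le_one_of_nonpos hq (by linarith [sq_nonneg (height θ)])
      (by norm_num)
  have hPbig : 1 - height θ ^ 2 ≤ P₀ ^ (-4 : ℝ) → P₀ ≤ (1 - height θ ^ 2) ^ (-(1 / 4) : ℝ) := by
    intro h
    have := Real.rpow_le_rpow_of_nonpos hq h (show (-(1 / 4) : ℝ) ≤ 0 by norm_num)
    rwa [← Real.rpow_mul (by linarith), show (-4 : ℝ) * -(1 / 4) = 1 by norm_num,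
      Real.rpow_one] at this
  rw [← height_eq_inner] at hb2 ho2 ha2
  rw [hp] at hb1 ⊢
  set P := (1 - height θ ^ 2) ^ (-(1 / 4) : ℝ)
  set A := stripBarrier δ 0 (northPole n).1 θ.1
  set B := stripBarrier δ T e θ.1
  -- The zeroth-order part of the conformal Laplacian helps, because the barrier is nonnegative.
  have hcn : 0 ≤ (n : ℝ) * (n - 2) / 4 * (6 + P + A + B) := by
    have : 0 ≤ (n : ℝ) * (n - 2) := mul_nonneg hd (by linarith)
    have : 0 ≤ 6 + P + A + B := by linarith
    positivity
  have hCψ : C * (6 + P + A + B) ≤ C * (6 + P) := mul_le_mul_of_nonneg_left (by linarith) hC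
  have hP5 : P ^ 2 ≤ P ^ 5 := pow_le_pow_right₀ hP1 (by norm_num)
  -- For large `P` the quintic term wins wherever the point lies. Otherwise the point lies in a
  -- strip, whose concavity contributes at most `-(M + 1)`.
  by_cases hPP : P₀ ≤ P
  · have h1 : P₀ * P ≤ P ^ 2 := by
      rw [sq]
      exact mul_le_mul_of_nonneg_right hPP (by linarith)
    have h2 : 8 * (n : ℝ) ≤ 8 * n * P := le_mul_of_one_le_right (by linarith) hP1
    have h3 : C ≤ C * P := le_mul_of_one_le_right hC hP1
    have h4 : P₀ * P = 8 * n * P + 28 * (C * P) + 5 * P := by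
      rw [hP₀]
      ring
    linarith only [hb1, hb2, hb3, ho2, ho3, hCψ, hcn, hP5, h1, h2, h3, h4, hP1, hd]
  · push Not at hPP
    have hCP : C * (6 + P) ≤ C * (6 + P₀) := mul_le_mul_of_nonneg_left (by linarith) hC
    have hP6 : 3 / 4 * P - 1 / 4 * P ^ 5 ≤ 1 / 2 := quintic_le_half hP1
    rcases hreg with h | h | h
    · exact absurd (hPbig h) (not_le.mpr hPP)
    · have ho2' := neg_sqrt_operator_le_of_near (c := 0) hδ0 hd ha2 (by simpa using h)
      have h1 : κ / (3 * δ) ≤ (1 - height θ ^ 2) / (3 * δ) := by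
        have h2 : height θ ^ 2 ≤ (1 / 2) ^ 2 := sq_le_sq' (by linarith [neg_abs_le (height θ)])
          (by linarith [le_abs_self (height θ)])
        gcongr
        linarith only [h2, hκ, hT0]
      linarith only [hb1, hb2, hb3, ho2', ho3, hP6, hCψ, hCP, hcn, hM, hδ4, h1]
    · have ho3' := neg_sqrt_operator_le_of_near (c := T) hδ0 hd ha3 h
      have h1 : κ / (3 * δ) ≤ (1 - ⟪θ.1, e⟫_ℝ ^ 2) / (3 * δ) := by
        have h2 := abs_le.mp h
        have h3 : κ ≤ 1 - ⟪θ.1, e⟫_ℝ := by linarith only [h2.2, hδ3, hκ]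
        have h4 : 0 ≤ ⟪θ.1, e⟫_ℝ := by linarith only [h2.1, hδ2]
        have h5 : ⟪θ.1, e⟫_ℝ ^ 2 ≤ ⟪θ.1, e⟫_ℝ := by
          rw [sq]
          exact mul_le_of_le_one_left h4 (by linarith only [h3, hκ0])
        gcongr
        linarith only [h3, h5]
      linarith only [hb1, hb2, hb3, ho2, ho3', hP6, hCψ, hCP, hcn, hM, hδ4, h1]

end Barrier

/-! ### The moving spheres argument -/

section MovingSpheres

variable {n : ℕ}

open Laplacian Filter
open scoped InnerProductSpace

theorem continuous_inner_coe (e : EuclideanSpace ℝ (Fin (n + 1))) :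
    Continuous fun θ : UnitSphere n => ⟪θ.1, e⟫_ℝ := by
  fun_prop

theorem continuous_height : Continuous (height : UnitSphere n → ℝ) := by
  have : (height : UnitSphere n → ℝ) = fun θ => ⟪θ.1, (northPole n).1⟫_ℝ := funext height_eq_inner
  rw [this]
  exact continuous_inner_coe _

theorem mem_puncturedSphere_of_inner_pos {e : EuclideanSpace ℝ (Fin (n + 1))}
    (heN : ⟪e, (northPole n).1⟫_ℝ = 0) {θ : UnitSphere n} (ht : 0 < ⟪θ.1, e⟫_ℝ) :
    θ ∈ puncturedSphere n :=
  (mem_puncturedSphere_iff θ).mpr (mem_offAxis_of_inner_ne_zero heN ht.ne')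

/-- Bounds for a solution and its reaction term on a cap that avoids the poles. -/
theorem exists_cap_bounds {g : UnitSphere n → ℝ → ℝ}
    (hg_cont : ContinuousOn (fun p : UnitSphere n × ℝ => g p.1 p.2)
      (puncturedSphere n ×ˢ Set.Ioi (0 : ℝ)))
    {v : UnitSphere n → ℝ} (hv : IsPositiveSolution g v) {e : EuclideanSpace ℝ (Fin (n + 1))}
    (heN : ⟪e, (northPole n).1⟫_ℝ = 0) {T : ℝ} (hT : 0 < T) :
    ∃ C, 0 ≤ C ∧ ∀ θ : UnitSphere n, T ≤ ⟪θ.1, e⟫_ℝ → g θ (v θ) ≤ C * v θ ∧ v θ ≤ C := by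
  have hK : IsCompact {θ : UnitSphere n | T ≤ ⟪θ.1, e⟫_ℝ} :=
    (isClosed_le continuous_const (continuous_inner_coe e)).isCompact
  have hsub : {θ : UnitSphere n | T ≤ ⟪θ.1, e⟫_ℝ} ⊆ puncturedSphere n :=
    fun θ hθ => mem_puncturedSphere_of_inner_pos heN (hT.trans_le hθ)
  have hvc : ContinuousOn v {θ : UnitSphere n | T ≤ ⟪θ.1, e⟫_ℝ} :=
    hv.contMDiffOn.continuousOn.mono hsub
  have hgc : ContinuousOn (fun θ => g θ (v θ)) {θ : UnitSphere n | T ≤ ⟪θ.1, e⟫_ℝ} :=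
    hg_cont.comp (continuousOn_id.prodMk hvc) fun θ hθ => ⟨hsub hθ, hv.pos θ (hsub hθ)⟩
  obtain ⟨C₁, h₁⟩ := hK.exists_bound_of_continuousOn
    (hgc.div hvc fun θ hθ => (hv.pos θ (hsub hθ)).ne')
  obtain ⟨C₂, h₂⟩ := hK.exists_bound_of_continuousOn hvc
  refine ⟨max 0 (max C₁ C₂), le_max_left _ _, fun θ hθ => ⟨?_, ?_⟩⟩
  · have h : g θ (v θ) / v θ ≤ C₁ := (le_abs_self _).trans (h₁ θ hθ)
    rw [div_le_iff₀ (hv.pos θ (hsub hθ))] at h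
    exact h.trans (mul_le_mul_of_nonneg_right ((le_max_left _ _).trans (le_max_right _ _))
      (hv.pos θ (hsub hθ)).le)
  · exact (le_abs_self _).trans ((h₂ θ hθ).trans ((le_max_right _ _).trans (le_max_right _ _)))

theorem exists_pos_eventually_le {v : UnitSphere n → ℝ} {p : UnitSphere n}
    (h : 0 < Filter.liminf (fun θ => ((v θ : ℝ) : EReal)) (𝓝[≠] p)) :
    ∃ c : ℝ, 0 < c ∧ ∃ U, IsOpen U ∧ p ∈ U ∧ ∀ θ ∈ U, θ ≠ p → c ≤ v θ := by
  obtain ⟨c, hc0, hc⟩ := EReal.lt_iff_exists_real_btwn.mp h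
  have h1 := eventually_lt_of_lt_liminf hc
  rw [eventually_nhdsWithin_iff] at h1
  obtain ⟨U, hU, hUo, hpU⟩ := eventually_nhds_iff.mp h1
  exact ⟨c, by exact_mod_cast hc0, U, hUo, hpU, fun θ hθ hne =>
    (EReal.coe_lt_coe_iff.mp (hU θ hθ hne)).le⟩

theorem exists_lower_bound {v : UnitSphere n → ℝ} (hvc : ContinuousOn v (puncturedSphere n))
    (hpos : ∀ θ ∈ puncturedSphere n, 0 < v θ)
    (hv_north : 0 < Filter.liminf (fun θ => ((v θ : ℝ) : EReal)) (𝓝[≠] (northPole n)))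
    (hv_south : 0 < Filter.liminf (fun θ => ((v θ : ℝ) : EReal)) (𝓝[≠] (southPole n))) :
    ∃ c : ℝ, 0 < c ∧ ∀ θ ∈ puncturedSphere n, c ≤ v θ := by
  obtain ⟨c₁, hc₁, U₁, hU₁, hp₁, h₁⟩ := exists_pos_eventually_le hv_north
  obtain ⟨c₂, hc₂, U₂, hU₂, hp₂, h₂⟩ := exists_pos_eventually_le hv_south
  have hK : IsCompact (U₁ ∪ U₂)ᶜ := (hU₁.union hU₂).isClosed_compl.isCompact
  have hsub : (U₁ ∪ U₂)ᶜ ⊆ puncturedSphere n := by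
    intro θ hθ
    constructor
    · rintro rfl
      exact hθ (Or.inl hp₁)
    · rintro rfl
      exact hθ (Or.inr hp₂)
  obtain ⟨c₃, hc₃, h₃⟩ : ∃ c₃ : ℝ, 0 < c₃ ∧ ∀ θ ∈ (U₁ ∪ U₂)ᶜ, c₃ ≤ v θ := by
    rcases (U₁ ∪ U₂)ᶜ.eq_empty_or_nonempty with h | h
    · exact ⟨1, one_pos, by simp [h]⟩
    · obtain ⟨θ₀, hθ₀, hmin⟩ := hK.exists_isMinOn h (hvc.mono hsub)
      exact ⟨v θ₀, hpos θ₀ (hsub hθ₀), hmin⟩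
  refine ⟨min c₁ (min c₂ c₃), by positivity, fun θ hθ => ?_⟩
  by_cases hu : θ ∈ U₁ ∪ U₂
  · rcases hu with hu | hu
    · exact (min_le_left _ _).trans (h₁ θ hu hθ.1)
    · exact ((min_le_right _ _).trans (min_le_left _ _)).trans (h₂ θ hu hθ.2)
  · exact ((min_le_right _ _).trans (min_le_right _ _)).trans (h₃ θ hu)

variable {e : EuclideanSpace ℝ (Fin (n + 1))}

theorem continuousOn_sub_reflected {v : UnitSphere n → ℝ}
    (hv : ContMDiffOn (𝓡 n) 𝓘(ℝ, ℝ) 2 v (puncturedSphere n)) (he : ‖e‖ = 1)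
    (heN : ⟪e, (northPole n).1⟫_ℝ = 0) {T : ℝ} (hT : T ∈ Set.Ioo 0 1) {A : Set (UnitSphere n)}
    (hA : A ⊆ puncturedSphere n) (hAT : ∀ θ ∈ A, ⟪θ.1, e⟫_ℝ ≤ T) :
    ContinuousOn (fun θ => v θ - reflected v e T θ) A := by
  refine (hv.continuousOn.mono hA).sub fun θ hθ => ContinuousAt.continuousWithinAt ?_
  have h1 := continuousAt_reflected hv (e := e) (T := T) (by nlinarith [hT.1, hT.2])
    (lorentz_mem_offAxis' he heN ⟨hT.1.le, hT.2⟩ (hA hθ) (hAT θ hθ))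
  exact h1.comp (f := fun θ => (T, θ)) (by fun_prop)

/-- Away from `e` the conformal factor `ν` grows at least like `1 / (1 - T ^ 2)`; it enters with a
negative power and multiplies values of `v` that are bounded on a fixed cap. -/
theorem eventually_reflected_lt {v : UnitSphere n → ℝ} (he : ‖e‖ = 1) (hn : 3 ≤ n)
    (heN : ⟪e, (northPole n).1⟫_ℝ = 0) (hpos : ∀ θ ∈ puncturedSphere n, 0 < v θ) {M c η : ℝ}
    (hM : ∀ θ : UnitSphere n, 1 / 2 ≤ ⟪θ.1, e⟫_ℝ → v θ ≤ M) (hc : 0 < c) (hη : 0 < η) :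
    ∀ᶠ T in 𝓝[<] (1 : ℝ), ∀ θ : UnitSphere n, ⟪θ.1, e⟫_ℝ ≤ 1 - η → reflected v e T θ < c := by
  have hk := conformalWeight_neg hn
  have h1 : Tendsto (fun T : ℝ => 1 - T ^ 2) (𝓝[<] 1) (𝓝[>] 0) := by
    refine tendsto_nhdsWithin_iff.mpr ⟨?_, ?_⟩
    · have : ContinuousAt (fun T : ℝ => 1 - T ^ 2) 1 := by fun_prop
      simpa using this.tendsto.mono_left nhdsWithin_le_nhds
    · filter_upwards [Ioo_mem_nhdsLT (show (0 : ℝ) < 1 by norm_num)] with T hT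
      exact Set.mem_Ioi.mpr (by nlinarith [hT.1, hT.2])
  have h2 : Tendsto (fun T : ℝ => η / 2 * (1 - T ^ 2)⁻¹) (𝓝[<] 1) atTop :=
    (tendsto_inv_nhdsGT_zero.comp h1).const_mul_atTop (by positivity)
  have h3 : Tendsto (fun T : ℝ => (η / 2 * (1 - T ^ 2)⁻¹) ^ conformalWeight n * M) (𝓝[<] 1)
      (𝓝 0) := by
    have h4 := (tendsto_rpow_neg_atTop (neg_pos.mpr hk)).comp h2
    simp only [neg_neg] at h4
    simpa using h4.mul_const M
  filter_upwards [h3.eventually (gt_mem_nhds hc),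
    Ioo_mem_nhdsLT (show max (1 / 2) (1 - η / 2) < 1 from max_lt (by norm_num) (by linarith))]
    with T hT hTI θ hθ
  have hT1 : 1 / 2 < T := (le_max_left _ _).trans_lt hTI.1
  have hT2 : 1 - η / 2 < T := (le_max_right _ _).trans_lt hTI.1
  have hT0 : T ∈ Set.Ioo 0 1 := ⟨by linarith, hTI.2⟩
  obtain ⟨θ', hm, ht', -, hr, -⟩ := exists_reflected_point he heN hT0
    (show ⟪θ.1, e⟫_ℝ < T by linarith) v
  have hd : 0 < 1 - T ^ 2 := by nlinarith [hT0.1, hT0.2]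
  have hν : η / 2 * (1 - T ^ 2)⁻¹ ≤ ‖lorentz e T θ.1‖ := by
    have h5 : η / 2 ≤ 2 * (T * (T - ⟪θ.1, e⟫_ℝ)) := by nlinarith
    have h6 := mul_le_mul_of_nonneg_right h5 (inv_nonneg.mpr hd.le)
    rw [norm_lorentz (norm_coe_unitSphere θ) he ⟨hT0.1.le, hT0.2⟩, div_eq_mul_inv 2]
    linarith
  have hν0 : 0 < η / 2 * (1 - T ^ 2)⁻¹ := by positivity
  have hvM := hM θ' (by linarith)
  rw [hr]
  refine lt_of_le_of_lt ?_ hT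
  exact mul_le_mul (Real.rpow_le_rpow_of_nonpos hν0 hν hk.le) hvM (hpos θ' hm).le
    (Real.rpow_nonneg hν0.le _)

theorem one_le_critical_exponent (hn : 3 ≤ n) : 1 ≤ ((n : ℝ) + 2) / ((n : ℝ) - 2) := by
  have hn' : (3 : ℝ) ≤ n := by exact_mod_cast hn
  rw [le_div_iff₀ (by linarith)]
  linarith

/-- The moving spheres can be started: small caps. -/
theorem eventually_dominatesReflected_nhdsLT (hn : 3 ≤ n) {g : UnitSphere n → ℝ → ℝ}
    (hg_cont : ContinuousOn (fun p : UnitSphere n × ℝ => g p.1 p.2)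
      (puncturedSphere n ×ˢ Set.Ioi (0 : ℝ)))
    (hg1 : ∀ s : ℝ, 0 < s → RotationallySymmetric (fun θ => g θ s))
    (hg3 : ∀ θ ∈ puncturedSphere n, AntitoneOn (criticalQuotient g θ) (Set.Ioi (0 : ℝ)))
    (hg5 : MonotoneAwayFromEquator g) {v : UnitSphere n → ℝ} (hv : IsPositiveSolution g v)
    {c : ℝ} (hc : 0 < c) (hvc : ∀ θ ∈ puncturedSphere n, c ≤ v θ)
    (he : ‖e‖ = 1) (heN : ⟪e, (northPole n).1⟫_ℝ = 0) :
    ∀ᶠ T in 𝓝[<] (1 : ℝ), DominatesReflected v e T := by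
  have hn' : (3 : ℝ) ≤ n := by exact_mod_cast hn
  obtain ⟨C, hC, hbd⟩ := exists_cap_bounds hg_cont hv heN (show (0 : ℝ) < 1 / 2 by norm_num)
  set C' := ((n : ℝ) + 2) / ((n : ℝ) - 2) * C with hC'
  have hC'0 : 0 ≤ C' := mul_nonneg (by linarith [one_le_critical_exponent hn]) hC
  -- With `t = ⟪θ, e⟫`, the barrier `t - 1 + ε` has values at most `ε` but `Δψ ≤ -n t ≤ -9/4` on the
  -- collar `t ≥ 1 - ε / 2`, so `C' * ε ≤ 1` makes it a strict supersolution there.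
  obtain ⟨ε, hε0, hε1, hεC⟩ : ∃ ε : ℝ, 0 < ε ∧ ε ≤ 1 / 2 ∧ C' * ε ≤ 1 := by
    refine ⟨min (1 / 2) (1 / (C' + 1)), by positivity, min_le_left _ _, ?_⟩
    have h1 : C' * min (1 / 2) (1 / (C' + 1)) ≤ C' * (1 / (C' + 1)) :=
      mul_le_mul_of_nonneg_left (min_le_right _ _) hC'0
    have h2 : C' * (1 / (C' + 1)) ≤ 1 := by
      rw [mul_one_div, div_le_one (by linarith)]
      linarith
    linarith
  set ψ := zonalExt (conformalWeight n) (fun t => t - 1 + ε) e with hψ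
  filter_upwards [eventually_reflected_lt he hn heN hv.pos (fun θ hθ => (hbd θ hθ).2) hc
    (show 0 < ε / 2 by linarith), Ioo_mem_nhdsLT (show (1 / 2 : ℝ) < 1 by norm_num)]
    with T hfar hTI
  have hT : T ∈ Set.Ioo 0 1 := ⟨by linarith [hTI.1], hTI.2⟩
  intro θ₁ hθ₁ ht₁
  by_contra! hneg
  set A := {θ : UnitSphere n | 1 - ε / 2 ≤ ⟪θ.1, e⟫_ℝ ∧ ⟪θ.1, e⟫_ℝ ≤ T} with hA
  have hAsub : A ⊆ puncturedSphere n := fun θ hθ =>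
    mem_puncturedSphere_of_inner_pos heN (by linarith [hθ.1])
  have hAc : IsCompact A := by
    have h1 : IsClosed {θ : UnitSphere n | 1 - ε / 2 ≤ ⟪θ.1, e⟫_ℝ} :=
      isClosed_le continuous_const (continuous_inner_coe e)
    have h2 : IsClosed {θ : UnitSphere n | ⟪θ.1, e⟫_ℝ ≤ T} :=
      isClosed_le (continuous_inner_coe e) continuous_const
    exact (h1.inter h2).isCompact
  have hfar' : ∀ θ ∈ puncturedSphere n, ⟪θ.1, e⟫_ℝ ≤ 1 - ε / 2 → reflected v e T θ < v θ :=
    fun θ hθ ht => (hfar θ ht).trans_le (hvc θ hθ)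
  have hθ₁A : θ₁ ∈ A := by
    refine ⟨?_, ht₁.le⟩
    by_contra! h
    exact absurd (hfar' θ₁ hθ₁ h.le) (not_lt.mpr hneg.le)
  have hψpos : ∀ θ ∈ A, 0 < ψ θ.1 := by
    intro θ hθ
    rw [hψ, zonalExt_coe]
    linarith [hθ.1]
  have hψd (θ : UnitSphere n) : ContDiffAt ℝ 2 ψ θ.1 :=
    contDiffAt_zonalExt _ (norm_coe_unitSphere θ) (by fun_prop)
  obtain ⟨θ₀, hθ₀, m, hm, heq, hmin⟩ := exists_touching_multiple hAc
    (continuousOn_sub_reflected hv.contMDiffOn he heN hT hAsub fun θ hθ => hθ.2)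
    (ψ := fun θ => ψ θ.1)
    (fun θ _ => ((hψd θ).continuousAt.comp continuous_subtype_val.continuousAt).continuousWithinAt)
    hψpos hθ₁A
  have hm0 : 0 < m := lt_of_lt_of_le (div_pos (by linarith) (hψpos θ₁ hθ₁A)) hm
  have hψ0 := hψpos θ₀ hθ₀
  have hneg₀ : v θ₀ < reflected v e T θ₀ := by
    have := mul_pos hm0 hψ0
    linarith
  have ht₀ : ⟪θ₀.1, e⟫_ℝ < T := by
    refine lt_of_le_of_ne hθ₀.2 fun h => ?_
    rw [reflected_eq_self v h] at hneg₀
    exact lt_irrefl _ hneg₀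
  have hlow : 1 - ε / 2 < ⟪θ₀.1, e⟫_ℝ := by
    by_contra! h
    exact absurd (hfar' θ₀ (hAsub hθ₀) h) (not_lt.mpr hneg₀.le)
  have hnear : ∀ᶠ θ in 𝓝 θ₀, 0 ≤ v θ - reflected v e T θ + m * ψ θ.1 := by
    have h1 := (continuous_inner_coe e).continuousAt.eventually (gt_mem_nhds ht₀)
    have h2 := (continuous_inner_coe e).continuousAt.eventually (lt_mem_nhds hlow)
    filter_upwards [h1, h2] with θ h1 h2
    exact hmin θ ⟨h2.le, h1.le⟩
  have hbar := laplacian_barrier_nonneg hn hg1 hg3 hg5 hv he heN hT hC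
    (fun θ _ ht => (hbd θ (by linarith [hTI.1])).1) (hAsub hθ₀) ht₀ (hψd θ₀)
    (fun y hy t ht => zonalExt_smul _ _ _ hy ht) hm0 hψ0 hnear heq
  have hlap : Δ ψ θ₀.1 = (1 - ⟪θ₀.1, e⟫_ℝ ^ 2) * 0 - n * ⟪θ₀.1, e⟫_ℝ * 1 -
      n * (n - 2) / 4 * (⟪θ₀.1, e⟫_ℝ - 1 + ε) :=
    laplacian_zonalExt_coe he (f := fun t => t - 1 + ε) (f' := fun _ => 1) (by fun_prop)
      (Eventually.of_forall fun s => ((hasDerivAt_id s).sub_const 1).add_const ε)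
      (hasDerivAt_const _ _)
  have hψv : ψ θ₀.1 = ⟪θ₀.1, e⟫_ℝ - 1 + ε := by rw [hψ, zonalExt_coe]
  have h1 : 0 ≤ (n : ℝ) * (n - 2) / 4 * (⟪θ₀.1, e⟫_ℝ - 1 + ε) := by
    rw [← hψv]
    have : 0 ≤ (n : ℝ) * (n - 2) := mul_nonneg (by linarith) (by linarith)
    positivity
  have h2 : C' * ψ θ₀.1 ≤ C' * ε := mul_le_mul_of_nonneg_left
    (by rw [hψv]; linarith [hT.2]) hC'0
  have h3 : 3 * (3 / 4) ≤ (n : ℝ) * ⟪θ₀.1, e⟫_ℝ :=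
    mul_le_mul hn' (by linarith) (by norm_num) (by linarith)
  rw [← hC', hlap] at hbar
  linarith

/-- The moving spheres do not get stuck. -/
theorem DominatesReflected.eventually (hn : 3 ≤ n) {g : UnitSphere n → ℝ → ℝ}
    (hg_cont : ContinuousOn (fun p : UnitSphere n × ℝ => g p.1 p.2)
      (puncturedSphere n ×ˢ Set.Ioi (0 : ℝ)))
    (hg1 : ∀ s : ℝ, 0 < s → RotationallySymmetric (fun θ => g θ s))
    (hg3 : ∀ θ ∈ puncturedSphere n, AntitoneOn (criticalQuotient g θ) (Set.Ioi (0 : ℝ)))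
    (hg5 : MonotoneAwayFromEquator g)
    (hg6 : StrictMonotoneAwayFromEquator g ∨
      ∀ θ ∈ puncturedSphere n, StrictAntiOn (criticalQuotient g θ) (Set.Ioi (0 : ℝ)))
    {v : UnitSphere n → ℝ} (hv : IsPositiveSolution g v)
    (he : ‖e‖ = 1) (heN : ⟪e, (northPole n).1⟫_ℝ = 0) {T₀ : ℝ} (hT₀ : T₀ ∈ Set.Ioo 0 1)
    (hdom : DominatesReflected v e T₀) : ∀ᶠ T in 𝓝 T₀, DominatesReflected v e T := by
  -- Bounds on the larger cap of parameter `T₀ / 2` serve all `T` near `T₀` at once, so the barrier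
  -- can be fixed before `T`.
  obtain ⟨C, hC, hbd⟩ := exists_cap_bounds hg_cont hv heN (half_pos hT₀.1)
  have hC'0 : 0 ≤ ((n : ℝ) + 2) / ((n : ℝ) - 2) * C :=
    mul_nonneg (by linarith [one_le_critical_exponent hn]) hC
  obtain ⟨ψ, δ, r, hδ, hr, hψd, hψhom, hψP, hψlap⟩ := exists_barrier hn he hT₀ hC'0
  -- The points on the far side where the barrier gives no information; they stay away from the
  -- poles, the equator and the boundary of the cap.
  set K := {θ : UnitSphere n | (r ≤ 1 - height θ ^ 2 ∧ δ ≤ |height θ|) ∧ ⟪θ.1, e⟫_ℝ ≤ T₀ - δ}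
    with hK
  have hKc : IsCompact K := by
    have h1 : IsClosed {θ : UnitSphere n | r ≤ 1 - height θ ^ 2} :=
      isClosed_le continuous_const (continuous_const.sub (continuous_height.pow 2))
    have h2 : IsClosed {θ : UnitSphere n | δ ≤ |height θ|} :=
      isClosed_le continuous_const continuous_height.abs
    have h3 : IsClosed {θ : UnitSphere n | ⟪θ.1, e⟫_ℝ ≤ T₀ - δ} :=
      isClosed_le (continuous_inner_coe e) continuous_const
    exact ((h1.inter h2).inter h3).isCompact
  have hKsub : K ⊆ puncturedSphere n := fun θ hθ =>
    (mem_puncturedSphere_iff_height θ).mpr (by linarith [hθ.1.1])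
  have hKev : ∀ᶠ T in 𝓝 T₀, ∀ θ ∈ K, reflected v e T θ < v θ := by
    refine hKc.eventually_forall_of_forall_eventually fun θ hθ => ?_
    have ht : ⟪θ.1, e⟫_ℝ < T₀ := by linarith [hθ.2]
    have h0 : height θ ≠ 0 := abs_pos.mp (hδ.trans_le hθ.1.2)
    have h1 := hdom.lt hn hg1 hg3 hg5 hg6 hv he heN hT₀ (hKsub hθ) ht h0
    have h2 := continuousAt_reflected hv.contMDiffOn (e := e) (T := T₀)
      (by nlinarith [hT₀.1, hT₀.2]) (lorentz_mem_offAxis he heN ⟨hT₀.1.le, hT₀.2⟩ ht)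
    have h3 : ContinuousAt (fun q : ℝ × UnitSphere n => v q.2) (T₀, θ) :=
      (hv.contMDiffOn.continuousOn.continuousAt
        (isOpen_puncturedSphere.mem_nhds (hKsub hθ))).comp continuousAt_snd
    exact h2.eventually_lt h3 h1
  filter_upwards [hKev, Ioo_mem_nhds hT₀.1 hT₀.2, Ioo_mem_nhds (half_lt_self hT₀.1) hT₀.2,
    Ioo_mem_nhds (sub_lt_self T₀ hδ) (lt_add_of_pos_right T₀ hδ)] with T hTK hT hThalf hTδ
  intro θ₁ hθ₁ ht₁
  by_contra! hneg
  have hqpos : ∀ θ ∈ puncturedSphere n, 0 < 1 - height θ ^ 2 := fun θ hθ =>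
    sub_pos.mpr ((mem_puncturedSphere_iff_height θ).mp hθ)
  have hψpos : ∀ θ ∈ puncturedSphere n, 0 < ψ θ.1 := fun θ hθ =>
    (Real.rpow_pos_of_pos (hqpos θ hθ) _).trans_le (hψP θ hθ)
  set m₁ := -(v θ₁ - reflected v e T θ₁) / ψ θ₁.1 with hm₁
  have hm₁0 : 0 < m₁ := div_pos (by linarith) (hψpos θ₁ hθ₁)
  have hrefl : ∀ θ : UnitSphere n, ⟪θ.1, e⟫_ℝ < T → reflected v e T θ ≤ C := by
    intro θ ht
    obtain ⟨θ', hm', ht', -, hr', -⟩ := exists_reflected_point he heN hT ht v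
    have hν := one_lt_norm_lorentz (norm_coe_unitSphere θ) he hT ht
    have h1 := Real.rpow_le_one_of_one_le_of_nonpos hν.le (conformalWeight_neg hn).le
    rw [hr']
    exact (mul_le_of_le_one_left (hv.pos θ' hm').le h1).trans (hbd θ' (by linarith [hThalf.1])).2
  -- Chosen so that `1 - height θ ^ 2 < ρ` forces `ψ ≥ C / m₁ + 1`; then `m₁ * ψ` exceeds the bound
  -- `C` of the reflected function, and no touching occurs near a pole.
  set ρ := (C / m₁ + 1) ^ (-4 : ℝ) with hρ
  have hρ0 : 0 < ρ := by positivity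
  have hpole : ∀ θ ∈ puncturedSphere n, ⟪θ.1, e⟫_ℝ < T → 1 - height θ ^ 2 < ρ →
      0 < v θ - reflected v e T θ + m₁ * ψ θ.1 := by
    intro θ hθ ht hq
    have h1 := Real.rpow_le_rpow_of_nonpos (hqpos θ hθ) hq.le (show (-(1 / 4) : ℝ) ≤ 0 by norm_num)
    rw [hρ, ← Real.rpow_mul (by positivity), show (-4 : ℝ) * -(1 / 4) = 1 by norm_num,
      Real.rpow_one] at h1
    have h2 : m₁ * (C / m₁ + 1) ≤ m₁ * ψ θ.1 :=
      mul_le_mul_of_nonneg_left (h1.trans (hψP θ hθ)) hm₁0.le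
    have h3 : m₁ * (C / m₁ + 1) = C + m₁ := by field_simp
    have := hrefl θ ht
    have := hv.pos θ hθ
    linarith
  set A := {θ : UnitSphere n | ρ ≤ 1 - height θ ^ 2 ∧ ⟪θ.1, e⟫_ℝ ≤ T} with hA
  have hAsub : A ⊆ puncturedSphere n := fun θ hθ =>
    (mem_puncturedSphere_iff_height θ).mpr (by linarith [hθ.1])
  have hAc : IsCompact A := by
    have h1 : IsClosed {θ : UnitSphere n | ρ ≤ 1 - height θ ^ 2} :=
      isClosed_le continuous_const (continuous_const.sub (continuous_height.pow 2))
    have h2 : IsClosed {θ : UnitSphere n | ⟪θ.1, e⟫_ℝ ≤ T} :=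
      isClosed_le (continuous_inner_coe e) continuous_const
    exact (h1.inter h2).isCompact
  have hθ₁A : θ₁ ∈ A := by
    refine ⟨?_, ht₁.le⟩
    by_contra! h
    have h1 := hpole θ₁ hθ₁ ht₁ h
    have h2 : m₁ * ψ θ₁.1 = -(v θ₁ - reflected v e T θ₁) :=
      div_mul_cancel₀ _ (hψpos θ₁ hθ₁).ne'
    linarith
  obtain ⟨θ₀, hθ₀, m, hm, heq, hmin⟩ := exists_touching_multiple hAc
    (continuousOn_sub_reflected hv.contMDiffOn he heN hT hAsub fun θ hθ => hθ.2)
    (ψ := fun θ => ψ θ.1)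
    (fun θ hθ => ((hψd θ (hAsub hθ)).continuousAt.comp
      continuous_subtype_val.continuousAt).continuousWithinAt)
    (fun θ hθ => hψpos θ (hAsub hθ)) hθ₁A
  have hm0 : 0 < m := hm₁0.trans_le hm
  have hθ₀p := hAsub hθ₀
  have hψ0 := hψpos θ₀ hθ₀p
  have hneg₀ : v θ₀ < reflected v e T θ₀ := by
    have := mul_pos hm0 hψ0
    linarith
  have ht₀ : ⟪θ₀.1, e⟫_ℝ < T := by
    refine lt_of_le_of_ne hθ₀.2 fun h => ?_
    rw [reflected_eq_self v h] at hneg₀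
    exact lt_irrefl _ hneg₀
  have hnear : ∀ᶠ θ in 𝓝 θ₀, 0 ≤ v θ - reflected v e T θ + m * ψ θ.1 := by
    have h1 := (continuous_inner_coe e).continuousAt.eventually (gt_mem_nhds ht₀)
    filter_upwards [h1, isOpen_puncturedSphere.mem_nhds hθ₀p] with θ h1 h2
    -- The touching point may lie on the edge of `A` towards a pole; beyond that edge `hpole`
    -- applies, since `m₁ ≤ m`.
    by_cases hρθ : ρ ≤ 1 - height θ ^ 2
    · exact hmin θ ⟨hρθ, h1.le⟩
    · have h3 := hpole θ h2 h1 (not_le.mp hρθ)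
      have h4 := mul_le_mul_of_nonneg_right hm (hψpos θ h2).le
      linarith
  have hbar := laplacian_barrier_nonneg hn hg1 hg3 hg5 hv he heN hT hC
    (fun θ _ ht => (hbd θ (by linarith [hThalf.1])).1) hθ₀p ht₀ (hψd θ₀ hθ₀p)
    hψhom hm0 hψ0 hnear heq
  refine absurd hbar (not_le.mpr (hψlap θ₀ hθ₀p ?_))
  -- Outside the barrier's regions the touching point is either in `K`, where the difference is
  -- positive, or within `δ` of the hypersurface because `T < T₀ + δ`.
  by_contra! hcon
  by_cases ht : ⟪θ₀.1, e⟫_ℝ ≤ T₀ - δ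
  · exact absurd (hTK θ₀ ⟨⟨hcon.1.le, hcon.2.1.le⟩, ht⟩) (not_lt.mpr hneg₀.le)
  · exact absurd hcon.2.2 (not_lt.mpr (abs_le.mpr ⟨by linarith, by linarith [hTδ.2]⟩))

/-- For a fixed point the condition `⟪θ, e⟫ < T` is open in `T`, so the inequality at nearby
parameters passes to the limit; `T = 0` is allowed. -/
theorem dominatesReflected_of_mem_closure {v : UnitSphere n → ℝ}
    (hv : ContMDiffOn (𝓡 n) 𝓘(ℝ, ℝ) 2 v (puncturedSphere n)) (he : ‖e‖ = 1)
    (heN : ⟪e, (northPole n).1⟫_ℝ = 0) {T : ℝ} (hT : T ∈ Set.Ico 0 1)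
    (hcl : T ∈ closure {T | DominatesReflected v e T}) : DominatesReflected v e T := by
  intro θ hθ ht
  have h1 : ContinuousAt (fun S => reflected v e S θ) T :=
    (continuousAt_reflected hv (e := e) (T := T) (by nlinarith [hT.1, hT.2])
      (lorentz_mem_offAxis he heN hT ht)).comp (f := fun S => (S, θ)) (by fun_prop)
  have h2 : ∃ᶠ S in 𝓝 T, reflected v e S θ ≤ v θ :=
    ((mem_closure_iff_frequently.mp hcl).and_eventually (lt_mem_nhds ht)).mono
      fun S hS => hS.1 θ hθ hS.2
  by_contra! hlt
  exact h2 ((h1.eventually (lt_mem_nhds hlt)).mono fun S hS => not_le.mpr hS)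

/-- The moving spheres reach the great sphere orthogonal to `e`. -/
theorem dominatesReflected_zero (hn : 3 ≤ n) {g : UnitSphere n → ℝ → ℝ}
    (hg_cont : ContinuousOn (fun p : UnitSphere n × ℝ => g p.1 p.2)
      (puncturedSphere n ×ˢ Set.Ioi (0 : ℝ)))
    (hg1 : ∀ s : ℝ, 0 < s → RotationallySymmetric (fun θ => g θ s))
    (hg3 : ∀ θ ∈ puncturedSphere n, AntitoneOn (criticalQuotient g θ) (Set.Ioi (0 : ℝ)))
    (hg5 : MonotoneAwayFromEquator g)
    (hg6 : StrictMonotoneAwayFromEquator g ∨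
      ∀ θ ∈ puncturedSphere n, StrictAntiOn (criticalQuotient g θ) (Set.Ioi (0 : ℝ)))
    {v : UnitSphere n → ℝ} (hv : IsPositiveSolution g v)
    {c : ℝ} (hc : 0 < c) (hvc : ∀ θ ∈ puncturedSphere n, c ≤ v θ)
    (he : ‖e‖ = 1) (heN : ⟪e, (northPole n).1⟫_ℝ = 0) : DominatesReflected v e 0 := by
  set u := {T | T ∈ Set.Ioo (0 : ℝ) 1 ∧ DominatesReflected v e T} with hu
  have huo : IsOpen u := isOpen_iff_mem_nhds.mpr fun T hT =>
    inter_mem (isOpen_Ioo.mem_nhds hT.1)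
      (hT.2.eventually hn hg_cont hg1 hg3 hg5 hg6 hv he heN hT.1)
  have hne : (Set.Ioo (0 : ℝ) 1 ∩ u).Nonempty := by
    obtain ⟨T, hT, hTI⟩ := ((eventually_dominatesReflected_nhdsLT hn hg_cont hg1 hg3 hg5 hv hc hvc
      he heN).and (Ioo_mem_nhdsLT (show (0 : ℝ) < 1 by norm_num))).exists
    exact ⟨T, hTI, hTI, hT⟩
  have hcl : closure u ∩ Set.Ioo (0 : ℝ) 1 ⊆ u := fun T hT =>
    ⟨hT.2, dominatesReflected_of_mem_closure hv.contMDiffOn he heN ⟨hT.2.1.le, hT.2.2⟩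
      (closure_mono (fun S hS => hS.2) hT.1)⟩
  have hall := isPreconnected_Ioo.subset_of_closure_inter_subset huo hne hcl
  refine dominatesReflected_of_mem_closure hv.contMDiffOn he heN ⟨le_rfl, one_pos⟩ ?_
  refine closure_mono (fun S hS => (hall hS).2 : Set.Ioo (0 : ℝ) 1 ⊆ _) ?_
  rw [closure_Ioo (by norm_num)]
  exact ⟨le_rfl, zero_le_one⟩

/-- With `e` along `θ - θ'`, which is orthogonal to the axis, the reflection at `T = 0` takes `θ'`
to `θ`, and `θ'` lies on the side where domination is known. -/
theorem le_of_dominatesReflected_zero {v : UnitSphere n → ℝ}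
    (h : ∀ e : EuclideanSpace ℝ (Fin (n + 1)), ‖e‖ = 1 → ⟪e, (northPole n).1⟫_ℝ = 0 →
      DominatesReflected v e 0) {θ θ' : UnitSphere n} (hθ' : θ' ∈ puncturedSphere n)
    (hh : height θ = height θ') : v θ ≤ v θ' := by
  rcases eq_or_ne θ θ' with rfl | hne
  · exact le_rfl
  set d := θ.1 - θ'.1 with hd
  have hd0 : d ≠ 0 := sub_ne_zero.mpr fun h => hne (Subtype.ext h)
  have hdn : ‖d‖ ≠ 0 := norm_ne_zero_iff.mpr hd0
  have hdN : ⟪d, (northPole n).1⟫_ℝ = 0 := by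
    rw [hd, inner_sub_left, ← height_eq_inner, ← height_eq_inner, hh, sub_self]
  have h1 := norm_coe_unitSphere θ
  have h2 := norm_coe_unitSphere θ'
  have hθd : ⟪θ'.1, d⟫_ℝ = -(‖d‖ ^ 2 / 2) := by
    rw [hd, norm_sub_sq_real, inner_sub_right, real_inner_self_eq_norm_sq, h1, h2,
      real_inner_comm]
    ring
  have hθe : ⟪θ'.1, ‖d‖⁻¹ • d⟫_ℝ = -(‖d‖ / 2) := by
    rw [real_inner_smul_right, hθd]
    field_simp
  have key := h (‖d‖⁻¹ • d) (by rw [norm_smul, norm_inv, norm_norm, inv_mul_cancel₀ hdn])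
    (by rw [real_inner_smul_left, hdN, mul_zero]) θ' hθ'
    (by rw [hθe]; have := norm_pos_iff.mpr hd0; linarith)
  have hrefl : lorentz (‖d‖⁻¹ • d) 0 θ'.1 = θ.1 := by
    rw [lorentz, hθe, smul_smul]
    have : 2 / (1 - (0 : ℝ) ^ 2) * (0 * ‖θ'.1‖ - -(‖d‖ / 2)) * ‖d‖⁻¹ = 1 := by
      field_simp
      norm_num
    rw [this, one_smul, hd, add_sub_cancel]
  rwa [reflected, hrefl, conformalExt_coe] at key

end MovingSpheres

end SphereSymmetry

theorem theorem1p5 (n : ℕ) (hn : 3 ≤ n)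
    (g : SphereSymmetry.UnitSphere n → ℝ → ℝ)
    (hg_cont : ContinuousOn (fun p : SphereSymmetry.UnitSphere n × ℝ => g p.1 p.2)
      (SphereSymmetry.puncturedSphere n ×ˢ Set.Ioi (0 : ℝ)))
    (hg_below : ∀ s : ℝ, 0 < s → ∃ C : ℝ, ∀ θ ∈ SphereSymmetry.puncturedSphere n, C ≤ g θ s)
    (hg1 : ∀ s : ℝ, 0 < s → SphereSymmetry.RotationallySymmetric (fun θ => g θ s))
    (hg3 : ∀ θ ∈ SphereSymmetry.puncturedSphere n,
      AntitoneOn (SphereSymmetry.criticalQuotient g θ) (Set.Ioi (0 : ℝ)))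
    (hg5 : SphereSymmetry.MonotoneAwayFromEquator g)
    (hg6 : SphereSymmetry.StrictMonotoneAwayFromEquator g ∨
      ∀ θ ∈ SphereSymmetry.puncturedSphere n,
        StrictAntiOn (SphereSymmetry.criticalQuotient g θ) (Set.Ioi (0 : ℝ)))
    (v : SphereSymmetry.UnitSphere n → ℝ)
    (hv : SphereSymmetry.IsPositiveSolution g v)
    (hv_north : 0 < Filter.liminf (fun θ => ((v θ : ℝ) : EReal))
      (𝓝[≠] (SphereSymmetry.northPole n)))
    (hv_south : 0 < Filter.liminf (fun θ => ((v θ : ℝ) : EReal))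
      (𝓝[≠] (SphereSymmetry.southPole n))) :
    SphereSymmetry.RotationallySymmetric v := by
  open SphereSymmetry in
  obtain ⟨c, hc, hvc⟩ :=
    exists_lower_bound hv.contMDiffOn.continuousOn hv.pos hv_north hv_south
  have hdom (e : EuclideanSpace ℝ (Fin (n + 1))) (he : ‖e‖ = 1)
      (heN : inner ℝ e (northPole n).1 = 0) : DominatesReflected v e 0 :=
    dominatesReflected_zero hn hg_cont hg1 hg3 hg5 hg6 hv hc hvc he heN
  intro R hR θ hθ
  have hheight : height (sphereMap R θ) = height θ := by
    have h1 : R (northPole n).1 = (northPole n).1 := congrArg Subtype.val hR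
    rw [height_eq_inner, height_eq_inner]
    conv_lhs => rw [← h1]
    exact R.inner_map_map _ _
  have hθ' : sphereMap R θ ∈ puncturedSphere n := by
    rw [mem_puncturedSphere_iff_height] at hθ ⊢
    rwa [hheight]
  -- The comparison is one-sided; it is applied with the two points in both roles.
  exact le_antisymm (le_of_dominatesReflected_zero hdom hθ hheight)
    (le_of_dominatesReflected_zero hdom hθ' hheight.symm)
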